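/- Let $\beta\in(0,\pi)$. Let $\mu_0^0<\mu_1^0<\dots$ be the eigenvalues of the problem $L(0,\pi,\beta)$: $$-y''=\mu y \text{ on } [0,\pi],\qquad y(0)=0,\qquad y(\pi)\cos\beta+y'(\pi)\sin\beta=0.$$ Put $\lambda_n^0=\sqrt{\mu_n^0}$, let $a_n^0=\int_0^\pi\big(\tfrac{\sin\lambda_n^0x}{\lambda_n^0}\big)^2dx$ be the norming constants, and let $\delta_n=\lambda_n^0-n$ for $n\ge 2$ (so $n+\delta_n=\lambda_n^0>0$). Let $\{\mu_n\}_{n\ge0}$ and $\{a_n\}_{n\ge0}$ be sequences of real numbers, $\lambda_n=\sqrt{\mu_n}$, such that $\mu_n\ne\mu_m$ for $n\neq m$, $a_n>0$ for all $n\ge 0$, and, for all $n\ge2$, $$\lambda_n=n+\delta_n+\frac{c}{2(n+\delta_n)}+l_n,\qquad a_n=\frac{\pi}{2(n+\delta_n)^2}\Big(1+\frac{2s_n}{\pi(n+\delta_n)}\Big),$$ where $c$ is a real constant, $l_n=o(1/n)$ and $s_n=o(1)$ as $n\to\infty$, and the series $$l(t)=\sum_{n\ge2}l_n\sin(n+\delta_n)t,\qquad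 s(t)=\sum_{n\ge2}\frac{s_n}{n+\delta_n}\cos(n+\delta_n)t$$ converge for every $t\in(0,2\pi)$ to functions that are absolutely continuous on every segment $[a,b]\subset(0,2\pi)$. (Finitely many $\mu_n$ may be negative or zero; square roots of negative numbers are imaginary, and the corresponding $l_n$ may be complex.) Then the series $$H(t)=\sum_{n=0}^\infty\Big(\frac1{a_n}\frac{\cos\lambda_nt}{\lambda_n^2}-\frac1{a_n^0}\frac{\cos\lambda_n^0t}{(\lambda_n^0)^2}\Big)$$ converges for every $t\in(0,2\pi)$. Here $\cos(\lambda t)/\lambda^2$ is replaced by $-t^2/2$, and above $\sin(\lambda x)/\lambda$ by $x$, if $\lambda=0$. With $F(x,t)=\tfrac12\big(H(|x-t|)-H(x+t)\big)$, for each fixed $x\in(0,\pi]$ the Gelfand–Levitan equation $$P(x,t)+F(x,t)+\int_0^xP(x,s)F(s,t)\,ds=0,\qquad 0\le t<x,$$ has a unique solution $P(x,\cdot)$ in the real space $L^2[0,x)$: there is a square-integrable function that satisfies the equation for every $t\in[0,x)$, and every square-integrable function that satisfies it for almost every $t\in[0,x)$ agrees with it almost everywhere. -/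

import Mathlib

open Filter Topology MeasureTheory Set

noncomputable section

namespace SturmLiouville

/-- The set of (real) eigenvalues `μ` of the problem `L(0, π, β)`:
`-y'' = μ y` on `[0, π]`, `y(0) = 0`, `y(π) cos β + y'(π) sin β = 0`, with `y` not identically
zero. The function `dy` is the derivative of `y`. -/
def eigenvalueSet (β : ℝ) : Set ℝ :=
  {μ | ∃ y dy : ℝ → ℝ,
    (∀ x ∈ Icc 0 Real.pi, HasDerivWithinAt y (dy x) (Icc 0 Real.pi) x) ∧
    (∀ x ∈ Icc 0 Real.pi, HasDerivWithinAt dy (-(μ * y x)) (Icc 0 Real.pi) x) ∧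
    y 0 = 0 ∧ y Real.pi * Real.cos β + dy Real.pi * Real.sin β = 0 ∧
    ∃ x ∈ Icc 0 Real.pi, y x ≠ 0}

/-- The eigenvalues `μ_n(0, π, β)` of `L(0, π, β)`, enumerated in increasing order:
`μ_0` is the smallest eigenvalue and `μ_{n+1}` the smallest one above `μ_n`. -/
def freeEigenvalue (β : ℝ) : ℕ → ℝ
  | 0 => sInf (eigenvalueSet β)
  | n + 1 => sInf {μ ∈ eigenvalueSet β | freeEigenvalue β n < μ}

/-- `sin (λ x) / λ` with `λ² = μ`, read as `x` when `μ = 0`: the solution of `-y'' = μ y`,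
`y(0) = 0`, `y'(0) = 1`. For `μ < 0` the number `λ` is imaginary and the quotient is still real. -/
def sinKernel (μ x : ℝ) : ℝ :=
  if μ = 0 then x
  else (Complex.sin (Complex.sqrt (μ : ℂ) * (x : ℂ)) / Complex.sqrt (μ : ℂ)).re

/-- `cos (λ t) / λ²` with `λ² = μ`, replaced by `-t² / 2` when `μ = 0`. For `μ < 0` the number
`λ` is imaginary and the quotient is still real. -/
def cosKernel (μ t : ℝ) : ℝ :=
  if μ = 0 then -(t ^ 2 / 2)
  else (Complex.cos (Complex.sqrt (μ : ℂ) * (t : ℂ)) / (Complex.sqrt (μ : ℂ)) ^ 2).re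

/-- The norming constants `a_n(0, π, β) = ∫_0^π φ_n²` of `L(0, π, β)`. -/
def freeNorming (β : ℝ) (n : ℕ) : ℝ :=
  ∫ x in (0 : ℝ)..Real.pi, (sinKernel (freeEigenvalue β n) x) ^ 2

/-- `δ_n(π, β) = √(μ_n(0, π, β)) - n`, used only for `n ≥ 2` (where `μ_n(0, π, β) > 0`). -/
def delta (β : ℝ) (n : ℕ) : ℝ := Real.sqrt (freeEigenvalue β n) - n

/-- `n + δ_n(π, β)`, for `n ≥ 2`. -/
def freq (β : ℝ) (n : ℕ) : ℝ := n + delta β n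

/-- `f` is absolutely continuous on every segment `[a, b] ⊂ (0, 2π)`. -/
def LocAC {X : Type*} [PseudoMetricSpace X] (f : ℝ → X) : Prop :=
  ∀ a b : ℝ, 0 < a → a ≤ b → b < 2 * Real.pi → AbsolutelyContinuousOnInterval f a b

/-- The conditions on the data `{μ_n}`, `{a_n}`, relative to `β`. The numbers `δ_n(π, β)` exist for
`n ≥ 2` only, so the asymptotic formulae are required for these `n`. As finitely many `μ_n` may be
negative, `√μ_n` and `l_n` are complex numbers. The trigonometric series need not converge
absolutely; their sums are limits of partial sums at every point of `(0, 2π)`. -/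
def SpectralData (β : ℝ) (μ a : ℕ → ℝ) : Prop :=
  Function.Injective μ ∧ (∀ n, 0 < a n) ∧
  ∃ (c : ℝ) (l : ℕ → ℂ) (s : ℕ → ℝ),
    (∀ n, 2 ≤ n → Complex.sqrt (μ n : ℂ) =
      (freq β n : ℂ) + (c : ℂ) / (2 * (freq β n : ℂ)) + l n) ∧
    (∀ n, 2 ≤ n → a n =
      Real.pi / (2 * (freq β n) ^ 2) * (1 + 2 * s n / (Real.pi * freq β n))) ∧
    l =o[atTop] (fun n : ℕ => 1 / (n : ℝ)) ∧
    s =o[atTop] (fun _ : ℕ => (1 : ℝ)) ∧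
    (∃ L : ℝ → ℂ, LocAC L ∧ ∀ t ∈ Ioo 0 (2 * Real.pi),
      Tendsto (fun N => ∑ n ∈ Finset.Ico 2 N, l n * (Real.sin (freq β n * t) : ℂ))
        atTop (𝓝 (L t))) ∧
    (∃ S : ℝ → ℝ, LocAC S ∧ ∀ t ∈ Ioo 0 (2 * Real.pi),
      Tendsto (fun N => ∑ n ∈ Finset.Ico 2 N, s n / freq β n * Real.cos (freq β n * t))
        atTop (𝓝 (S t)))

/-- The partial sums of the series that defines `H`. -/
def partialH (β : ℝ) (μ a : ℕ → ℝ) (N : ℕ) (t : ℝ) : ℝ :=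
  ∑ n ∈ Finset.range N, (1 / a n * cosKernel (μ n) t
    - 1 / freeNorming β n * cosKernel (freeEigenvalue β n) t)

/-- `H(t) = ∑_n (cos (λ_n t) / (a_n λ_n²) - cos (λ_n⁰ t) / (a_n⁰ (λ_n⁰)²))`, the limit of the
partial sums. -/
def H (β : ℝ) (μ a : ℕ → ℝ) (t : ℝ) : ℝ :=
  limUnder atTop (fun N => partialH β μ a N t)

/-- `F(x, t) = (H(|x - t|) - H(x + t)) / 2`. -/
def F (β : ℝ) (μ a : ℕ → ℝ) (x t : ℝ) : ℝ :=
  1 / 2 * (H β μ a |x - t| - H β μ a (x + t))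

/-- The Gelfand–Levitan equation at the point `t` for the function `p = P(x, ·)`. -/
def GelfandLevitanAt (β : ℝ) (μ a : ℕ → ℝ) (x : ℝ) (p : ℝ → ℝ) (t : ℝ) : Prop :=
  p t + F β μ a x t + ∫ s in (0 : ℝ)..x, p s * F β μ a s t = 0

end SturmLiouville

end

noncomputable section

namespace SturmLiouville

open Asymptotics

/-! Write `φ_n(t) = sin (λ_n t) / λ_n`, and `φ_n⁰` for the free problem. By the product formula
`half_cosKernel_sub`, `F(s, t)` is formally `∑ (φ_n(s) φ_n(t) / a_n - φ_n⁰(s) φ_n⁰(t) / a_n⁰)`. If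
`K` is the integral operator on `L²(0, x)` with kernel `F`, the equation reads `(1 + K) P = -F(x,
·)`. Once `K` is known to be compact, the Fredholm alternative leaves only the injectivity of `1 +
K`.

Injectivity (`eq_zero_of_limit_eq_neg`): if `K p = -p`, pairing with `p` shows that the partial sums
of `∑ (⟨φ_n, p⟩² / a_n - ⟨φ_n⁰, p⟩² / a_n⁰)` tend to `-‖p‖²`. The free eigenfunctions are orthogonal
on `(0, π)` with squared norms `a_n⁰`, so Bessel's inequality for `p` extended by zero bounds the
free part by `‖p‖²`. As `a_n > 0`, every `⟨φ_n, p⟩` vanishes, and completeness of the `φ_n` in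
`L²(0, π)` gives `p = 0`.

Completeness (`isCompleteSystem_range`): since `λ_n = n + 1/2 + O(1/n)`, a far tail of the system is
quadratically close to that of the orthogonal basis `sin ((n + 1/2) t)`, so the tail together with
finitely many basis members is complete. These members are then exchanged for the missing `φ_n` one
at a time (`IsCompleteSystem.exchange`).

Compactness: by `termH_bound` the terms of `H` are `-(2/π) (σ_n cos (f_n t) + t ε_n sin (f_n t)) +
O(1/n²)` with `f_n = n + δ_n` and `σ_n, ε_n = O(1/n)`. The assumed convergence of the two
trigonometric series, with Dirichlet's test for the part that comes from `c`, gives pointwise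
convergence. Replacing `f_n` by `n + 1/2` costs `O(1/n²)`, and orthogonality on `(0, 2π)` gives
convergence in `L²(0, 2π)`. That norm controls the operator norm, so `K` is a norm limit of
finite-rank operators. -/

/-! ### The kernels `sin (λ x) / λ`, `cos (λ x)` and `cos (λ t) / λ²` -/

/-- `cos (λ x)` with `λ² = μ`: the derivative of `sinKernel μ`. -/
def cosSol (μ x : ℝ) : ℝ := (Complex.cos (Complex.sqrt (μ : ℂ) * (x : ℂ))).re

/-- One of the two real roots is always zero, so both signs of `μ` are covered at once. Continuity
along the real line becomes visible although the branch cut is the negative half-axis. -/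
lemma sqrt_ofReal_eq (μ : ℝ) :
    Complex.sqrt (μ : ℂ) = (Real.sqrt μ : ℂ) + (Real.sqrt (-μ) : ℂ) * Complex.I := by
  rw [Complex.sqrt_eq_real_add_ite]
  rcases le_total 0 μ with h | h
  · have h1 : Real.sqrt (-μ) = 0 := Real.sqrt_eq_zero_of_nonpos (by linarith)
    simp [abs_of_nonneg h, h1]
  · have h1 : Real.sqrt μ = 0 := Real.sqrt_eq_zero_of_nonpos h
    have h2 : (-μ - μ) / 2 = -μ := by ring
    simp [abs_of_nonpos h, h1, h2]

lemma sqrt_ofReal_sq (μ : ℝ) : Complex.sqrt (μ : ℂ) ^ 2 = (μ : ℂ) := by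
  rw [Complex.sqrt, ← Complex.cpow_nat_mul]
  norm_num

lemma sqrt_ofReal_ne_zero {μ : ℝ} (h : μ ≠ 0) : Complex.sqrt (μ : ℂ) ≠ 0 := by
  intro h0
  have := sqrt_ofReal_sq μ
  rw [h0] at this
  apply h
  exact_mod_cast (by simpa using this.symm : (μ : ℂ) = 0)

lemma continuous_sqrt_ofReal : Continuous fun μ : ℝ => Complex.sqrt (μ : ℂ) := by
  simp_rw [sqrt_ofReal_eq]
  fun_prop

lemma sqrt_ofReal_of_pos {μ : ℝ} (h : 0 ≤ μ) : Complex.sqrt (μ : ℂ) = (Real.sqrt μ : ℂ) := by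
  rw [sqrt_ofReal_eq, Real.sqrt_eq_zero_of_nonpos (by linarith : -μ ≤ 0)]
  simp

lemma sqrt_ofReal_of_neg {μ : ℝ} (h : μ ≤ 0) :
    Complex.sqrt (μ : ℂ) = (Real.sqrt (-μ) : ℂ) * Complex.I := by
  rw [sqrt_ofReal_eq, Real.sqrt_eq_zero_of_nonpos h]
  simp

/-- The removable singularity of `sin z / z` is absorbed into `dslope`; joint continuity, including
at `μ = 0`, follows without cases. -/
lemma sinKernel_eq_dslope (μ x : ℝ) :
    sinKernel μ x = ((x : ℂ) * dslope Complex.sin 0 (Complex.sqrt (μ : ℂ) * x)).re := by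
  unfold sinKernel
  split_ifs with h
  · simp [h]
  · by_cases hx : x = 0
    · simp [hx]
    have hz := sqrt_ofReal_ne_zero h
    have hx' : (x : ℂ) ≠ 0 := by exact_mod_cast hx
    rw [dslope_of_ne _ (mul_ne_zero hz hx'), slope_def_field]
    congr 1
    simp
    field_simp

lemma continuous_dslope_sin : Continuous (dslope Complex.sin 0) := by
  rw [← continuousOn_univ, continuousOn_dslope univ_mem]
  exact ⟨Complex.continuous_sin.continuousOn, Complex.differentiable_sin 0⟩

lemma continuous_sinKernel : Continuous fun p : ℝ × ℝ => sinKernel p.1 p.2 := by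
  simp_rw [sinKernel_eq_dslope]
  refine Complex.continuous_re.comp ((Complex.continuous_ofReal.comp continuous_snd).mul
    (continuous_dslope_sin.comp ?_))
  exact (continuous_sqrt_ofReal.comp continuous_fst).mul
    (Complex.continuous_ofReal.comp continuous_snd)

lemma continuous_cosSol_left (x : ℝ) : Continuous fun μ => cosSol μ x :=
  Complex.continuous_re.comp (Complex.continuous_cos.comp
    (continuous_sqrt_ofReal.mul continuous_const))

lemma continuous_cosSol_right (μ : ℝ) : Continuous fun x => cosSol μ x :=
  Complex.continuous_re.comp (Complex.continuous_cos.comp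
    (continuous_const.mul Complex.continuous_ofReal))

attribute [fun_prop] continuous_cosSol_right

@[fun_prop]
lemma continuous_sinKernel_comp {X : Type*} [TopologicalSpace X] {f g : X → ℝ}
    (hf : Continuous f) (hg : Continuous g) :
    Continuous fun x => sinKernel (f x) (g x) :=
  Continuous.comp (g := fun p : ℝ × ℝ => sinKernel p.1 p.2) continuous_sinKernel
    (hf.prodMk hg)

@[simp] lemma sinKernel_zero_right (μ : ℝ) : sinKernel μ 0 = 0 := by
  simp [sinKernel_eq_dslope]

@[simp] lemma cosSol_zero_right (μ : ℝ) : cosSol μ 0 = 1 := by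
  simp [cosSol]

lemma sinKernel_of_pos {μ : ℝ} (h : 0 < μ) (x : ℝ) :
    sinKernel μ x = Real.sin (Real.sqrt μ * x) / Real.sqrt μ := by
  rw [sinKernel, if_neg h.ne', sqrt_ofReal_of_pos h.le]
  norm_cast

lemma sinKernel_of_neg {μ : ℝ} (h : μ < 0) (x : ℝ) :
    sinKernel μ x = Real.sinh (Real.sqrt (-μ) * x) / Real.sqrt (-μ) := by
  rw [sinKernel, if_neg h.ne, sqrt_ofReal_of_neg h.le]
  have h2 : (Real.sqrt (-μ) : ℂ) * Complex.I * x = (Real.sqrt (-μ) * x : ℝ) * Complex.I := by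
    push_cast; ring
  rw [h2, Complex.sin_mul_I, mul_div_mul_right _ _ Complex.I_ne_zero]
  norm_cast

lemma sinKernel_zero_left (x : ℝ) : sinKernel 0 x = x := by simp [sinKernel]

lemma cosSol_of_nonneg {μ : ℝ} (h : 0 ≤ μ) (x : ℝ) : cosSol μ x = Real.cos (Real.sqrt μ * x) := by
  rw [cosSol, sqrt_ofReal_of_pos h]
  norm_cast

lemma cosSol_of_nonpos {μ : ℝ} (h : μ ≤ 0) (x : ℝ) :
    cosSol μ x = Real.cosh (Real.sqrt (-μ) * x) := by
  rw [cosSol, sqrt_ofReal_of_neg h]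
  have h2 : (Real.sqrt (-μ) : ℂ) * Complex.I * x = (Real.sqrt (-μ) * x : ℝ) * Complex.I := by
    push_cast; ring
  rw [h2, Complex.cos_mul_I]
  norm_cast

lemma cosKernel_of_ne {μ : ℝ} (h : μ ≠ 0) (t : ℝ) : cosKernel μ t = cosSol μ t / μ := by
  rw [cosKernel, if_neg h, sqrt_ofReal_sq, cosSol]
  exact Complex.div_ofReal_re _ _

lemma cosKernel_zero_left (t : ℝ) : cosKernel 0 t = -(t ^ 2 / 2) := by simp [cosKernel]

lemma cosKernel_of_pos {μ : ℝ} (h : 0 < μ) (t : ℝ) :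
    cosKernel μ t = Real.cos (Real.sqrt μ * t) / μ := by
  rw [cosKernel_of_ne h.ne', cosSol_of_nonneg h.le]

lemma cosKernel_of_neg {μ : ℝ} (h : μ < 0) (t : ℝ) :
    cosKernel μ t = Real.cosh (Real.sqrt (-μ) * t) / μ := by
  rw [cosKernel_of_ne h.ne, cosSol_of_nonpos h.le]

@[fun_prop]
lemma continuous_cosKernel (μ : ℝ) : Continuous (cosKernel μ) := by
  by_cases h : μ = 0
  · subst h
    simp_rw [funext cosKernel_zero_left]
    fun_prop
  · simp_rw [funext (cosKernel_of_ne h)]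
    fun_prop

lemma hasDerivAt_sinKernel (μ x : ℝ) : HasDerivAt (sinKernel μ) (cosSol μ x) x := by
  rcases lt_trichotomy μ 0 with h | rfl | h
  · rw [funext (sinKernel_of_neg h), cosSol_of_nonpos h.le]
    have h0 : Real.sqrt (-μ) ≠ 0 := (Real.sqrt_pos.2 (by linarith)).ne'
    have := (((hasDerivAt_id' x).const_mul (Real.sqrt (-μ))).sinh).div_const (Real.sqrt (-μ))
    simpa [h0] using this
  · rw [funext sinKernel_zero_left, cosSol_of_nonneg le_rfl]
    simpa using hasDerivAt_id' x
  · rw [funext (sinKernel_of_pos h), cosSol_of_nonneg h.le]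
    have h0 : Real.sqrt μ ≠ 0 := (Real.sqrt_pos.2 h).ne'
    have := (((hasDerivAt_id' x).const_mul (Real.sqrt μ)).sin).div_const (Real.sqrt μ)
    simpa [h0] using this

lemma hasDerivAt_cosSol (μ x : ℝ) : HasDerivAt (cosSol μ) (-(μ * sinKernel μ x)) x := by
  rcases lt_trichotomy μ 0 with h | rfl | h
  · rw [funext (cosSol_of_nonpos h.le), sinKernel_of_neg h]
    have h0 : Real.sqrt (-μ) ≠ 0 := (Real.sqrt_pos.2 (by linarith)).ne'
    have h1 : Real.sqrt (-μ) * Real.sqrt (-μ) = -μ := Real.mul_self_sqrt (by linarith)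
    have := ((hasDerivAt_id' x).const_mul (Real.sqrt (-μ))).cosh
    refine this.congr_deriv ?_
    field_simp
    linear_combination (Real.sinh (Real.sqrt (-μ) * x)) * h1
  · rw [funext (cosSol_of_nonneg le_rfl)]
    simpa using hasDerivAt_const x (1 : ℝ)
  · rw [funext (cosSol_of_nonneg h.le), sinKernel_of_pos h]
    have h0 : Real.sqrt μ ≠ 0 := (Real.sqrt_pos.2 h).ne'
    have h1 : Real.sqrt μ * Real.sqrt μ = μ := Real.mul_self_sqrt h.le
    have := ((hasDerivAt_id' x).const_mul (Real.sqrt μ)).cos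
    refine this.congr_deriv ?_
    field_simp
    linear_combination (-Real.sin (Real.sqrt μ * x)) * h1

/-- The product formula behind `F(x, t) = ∑ …`. -/
lemma half_cosKernel_sub (μ s t : ℝ) :
    1 / 2 * (cosKernel μ |s - t| - cosKernel μ (s + t)) = sinKernel μ s * sinKernel μ t := by
  rcases lt_trichotomy μ 0 with h | rfl | h
  · simp only [cosKernel_of_neg h, sinKernel_of_neg h]
    have h0 : Real.sqrt (-μ) ≠ 0 := (Real.sqrt_pos.2 (by linarith)).ne'
    have h1 : Real.sqrt (-μ) ^ 2 = -μ := Real.sq_sqrt (by linarith)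
    have h2 : Real.cosh (Real.sqrt (-μ) * |s - t|) = Real.cosh (Real.sqrt (-μ) * (s - t)) := by
      rcases abs_choice (s - t) with h | h <;> rw [h]
      rw [mul_neg, Real.cosh_neg]
    rw [h2, mul_sub (Real.sqrt _), mul_add (Real.sqrt _), Real.cosh_sub, Real.cosh_add, div_mul_div_comm, ← sq, h1]
    have : μ ≠ 0 := h.ne
    field_simp
    ring
  · simp only [cosKernel_zero_left, sinKernel_zero_left, sq_abs]
    ring
  · simp only [cosKernel_of_pos h, sinKernel_of_pos h]
    have h0 : Real.sqrt μ ≠ 0 := (Real.sqrt_pos.2 h).ne'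
    have h1 : Real.sqrt μ ^ 2 = μ := Real.sq_sqrt h.le
    have h2 : Real.cos (Real.sqrt μ * |s - t|) = Real.cos (Real.sqrt μ * (s - t)) := by
      rcases abs_choice (s - t) with h | h <;> rw [h]
      rw [mul_neg, Real.cos_neg]
    rw [h2, mul_sub (Real.sqrt _), mul_add (Real.sqrt _), Real.cos_sub, Real.cos_add, div_mul_div_comm, ← sq, h1]
    field_simp
    ring

/-- Convolutions of two solutions. -/
lemma sub_mul_integral_sinKernel_conv (κ μ s : ℝ) :
    (κ - μ) * ∫ t in (0 : ℝ)..s, sinKernel κ t * sinKernel μ (s - t)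
      = sinKernel μ s - sinKernel κ s := by
  -- The differentiated function equals `sinKernel μ s` at `t = 0` and `sinKernel κ s` at `t = s`.
  have hder : ∀ t ∈ uIcc 0 s, HasDerivAt
      (fun t => sinKernel κ t * cosSol μ (s - t) + cosSol κ t * sinKernel μ (s - t))
      ((μ - κ) * (sinKernel κ t * sinKernel μ (s - t))) t := by
    intro t _
    have hs : HasDerivAt (fun t : ℝ => s - t) (-1) t := by
      simpa using (hasDerivAt_id t).const_sub s
    have h1 := (hasDerivAt_sinKernel κ t).fun_mul ((hasDerivAt_cosSol μ (s - t)).comp t hs)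
    have h2 := (hasDerivAt_cosSol κ t).fun_mul ((hasDerivAt_sinKernel μ (s - t)).comp t hs)
    refine (h1.fun_add h2).congr_deriv ?_
    simp only [Function.comp_apply]
    ring
  have := intervalIntegral.integral_eq_sub_of_hasDerivAt hder
    (Continuous.intervalIntegrable (by fun_prop) _ _)
  rw [intervalIntegral.integral_const_mul] at this
  simp at this
  linarith

/-- Lagrange's identity for two solutions. -/
lemma sub_mul_integral_sinKernel_mul (κ μ x : ℝ) :
    (κ - μ) * ∫ t in (0 : ℝ)..x, sinKernel κ t * sinKernel μ t
      = sinKernel κ x * cosSol μ x - cosSol κ x * sinKernel μ x := by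
  have hder : ∀ t ∈ uIcc 0 x, HasDerivAt
      (fun t => sinKernel κ t * cosSol μ t - cosSol κ t * sinKernel μ t)
      ((κ - μ) * (sinKernel κ t * sinKernel μ t)) t := by
    intro t _
    have h1 := (hasDerivAt_sinKernel κ t).fun_mul (hasDerivAt_cosSol μ t)
    have h2 := (hasDerivAt_cosSol κ t).fun_mul (hasDerivAt_sinKernel μ t)
    refine (h1.fun_sub h2).congr_deriv ?_
    ring
  have := intervalIntegral.integral_eq_sub_of_hasDerivAt hder
    (Continuous.intervalIntegrable (by fun_prop) _ _)
  rw [intervalIntegral.integral_const_mul] at this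
  simpa using this

/-- Variation of constants: a solution of `-y'' = μ y` on `[0, b]` is determined by its initial
values. -/
lemma eq_of_ode {μ b : ℝ} {y dy : ℝ → ℝ}
    (hy : ∀ x ∈ Icc 0 b, HasDerivWithinAt y (dy x) (Icc 0 b) x)
    (hdy : ∀ x ∈ Icc 0 b, HasDerivWithinAt dy (-(μ * y x)) (Icc 0 b) x) {s : ℝ}
    (hs : s ∈ Icc 0 b) : y s = y 0 * cosSol μ s + dy 0 * sinKernel μ s := by
  have hsub : Icc 0 s ⊆ Icc 0 b := Icc_subset_Icc_right hs.2
  -- This function is constant; its value at `t = s` is `y s`, and its value at `t = 0` is the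
  -- right-hand side.
  have hder : ∀ t ∈ Icc 0 s, HasDerivWithinAt
      (fun t => y t * cosSol μ (s - t) + dy t * sinKernel μ (s - t)) 0 (Icc 0 s) t := by
    intro t ht
    have hst : HasDerivWithinAt (fun t : ℝ => s - t) (-1) (Icc 0 s) t := by
      simpa using ((hasDerivAt_id t).const_sub s).hasDerivWithinAt
    have h1 := ((hy t (hsub ht)).mono hsub).fun_mul
      ((hasDerivAt_cosSol μ (s - t)).comp_hasDerivWithinAt t hst)
    have h2 := ((hdy t (hsub ht)).mono hsub).fun_mul
      ((hasDerivAt_sinKernel μ (s - t)).comp_hasDerivWithinAt t hst)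
    refine (h1.fun_add h2).congr_deriv ?_
    simp only [Function.comp_apply]
    ring
  have hconst := constant_of_has_deriv_right_zero (a := 0) (b := s)
    (fun t ht => (hder t ht).continuousWithinAt)
    (fun t ht => (hder t (Ico_subset_Icc_self ht)).mono_of_mem_nhdsWithin
      (Icc_mem_nhdsGE_of_mem ht))
  simpa using hconst s ⟨hs.1, le_rfl⟩

/-! ### Eigenvalues of the free problem -/

/-- The characteristic function of `L(0, π, β)`. -/
def charFun (β μ : ℝ) : ℝ :=
  sinKernel μ Real.pi * Real.cos β + cosSol μ Real.pi * Real.sin β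

lemma continuous_charFun (β : ℝ) : Continuous (charFun β) := by
  have := continuous_cosSol_left Real.pi
  unfold charFun
  fun_prop

/-- A solution with `y 0 = 0` is `dy 0` times `sinKernel μ`. It is nontrivial exactly when `dy 0 ≠
0`, so this factor can be cancelled from the boundary condition. -/
lemma mem_eigenvalueSet_iff {β μ : ℝ} : μ ∈ eigenvalueSet β ↔ charFun β μ = 0 := by
  have hpi := Real.pi_pos
  constructor
  · rintro ⟨y, dy, hy, hdy, h0, hb, x, hx, hne⟩
    have key : ∀ s ∈ Icc 0 Real.pi, y s = dy 0 * sinKernel μ s := fun s hs => by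
      simpa [h0] using eq_of_ode hy hdy hs
    have hd0 : dy 0 ≠ 0 := by
      intro h
      exact hne (by rw [key x hx, h, zero_mul])
    have hmem : Real.pi ∈ Icc 0 Real.pi := ⟨hpi.le, le_rfl⟩
    have hdpi : dy Real.pi = dy 0 * cosSol μ Real.pi := by
      have h1 := (hy _ hmem).congr (f₁ := fun s => dy 0 * sinKernel μ s)
        (fun s hs => (key s hs).symm) (key _ hmem).symm
      exact (uniqueDiffOn_Icc hpi _ hmem).eq_deriv _ h1
        ((hasDerivAt_sinKernel μ _).const_mul _).hasDerivWithinAt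
    rw [key _ hmem, hdpi] at hb
    have : dy 0 * charFun β μ = 0 := by rw [charFun]; linarith
    exact (mul_eq_zero.1 this).resolve_left hd0
  · intro h
    refine ⟨sinKernel μ, cosSol μ, fun x _ => (hasDerivAt_sinKernel μ x).hasDerivWithinAt,
      fun x _ => (hasDerivAt_cosSol μ x).hasDerivWithinAt, by simp, h, ?_⟩
    -- A function vanishing on `[0, π]` has one-sided derivative `0` at `0`, whereas `cosSol μ 0 =
    -- 1`.
    by_contra! hcon
    have h1 : HasDerivWithinAt (sinKernel μ) 0 (Icc 0 Real.pi) 0 :=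
      (hasDerivWithinAt_const 0 _ (0 : ℝ)).congr hcon (by simp)
    have h2 := (hasDerivAt_sinKernel μ 0).hasDerivWithinAt (s := Icc 0 Real.pi)
    have := (uniqueDiffOn_Icc hpi 0 ⟨le_rfl, hpi.le⟩).eq_deriv _ h1 h2
    simp at this

/-- Both boundary vectors `(sinKernel, cosSol)` at `π` are orthogonal to `(cos β, sin β)`, hence
parallel; the Wronskian in Lagrange's identity vanishes. -/
lemma integral_sinKernel_mul_eq_zero {β κ μ : ℝ} (hκ : κ ∈ eigenvalueSet β)
    (hμ : μ ∈ eigenvalueSet β) (hne : κ ≠ μ) :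
    ∫ t in (0 : ℝ)..Real.pi, sinKernel κ t * sinKernel μ t = 0 := by
  rw [mem_eigenvalueSet_iff, charFun] at hκ hμ
  have h := sub_mul_integral_sinKernel_mul κ μ Real.pi
  have hsc := Real.sin_sq_add_cos_sq β
  have h0 : sinKernel κ Real.pi * cosSol μ Real.pi - cosSol κ Real.pi * sinKernel μ Real.pi
      = 0 := by
    set a := sinKernel κ Real.pi
    set b := cosSol κ Real.pi
    set c := sinKernel μ Real.pi
    set d := cosSol μ Real.pi
    linear_combination (-(a * d - b * c)) * hsc +
      (Real.cos β * d - Real.sin β * c) * hκ + (Real.sin β * a - Real.cos β * b) * hμ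
  rw [h0] at h
  exact (mul_eq_zero.1 h).resolve_left (sub_ne_zero.2 hne)

lemma sinKernel_pos {μ x : ℝ} (hμ : μ < 1) (hx : 0 < x) (hxpi : x < Real.pi) :
    0 < sinKernel μ x := by
  rcases lt_trichotomy μ 0 with h | rfl | h
  · rw [sinKernel_of_neg h]
    have h0 : 0 < Real.sqrt (-μ) := Real.sqrt_pos.2 (by linarith)
    exact div_pos (Real.sinh_pos_iff.2 (by positivity)) h0
  · rwa [sinKernel_zero_left]
  · rw [sinKernel_of_pos h]
    have h0 : 0 < Real.sqrt μ := Real.sqrt_pos.2 h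
    have h1 : Real.sqrt μ < 1 := by rw [Real.sqrt_lt' one_pos]; linarith
    refine div_pos (Real.sin_pos_of_pos_of_lt_pi (by positivity) ?_) h0
    nlinarith

/-- Below `1` the solutions have no zero in `(0, π)`, and two positive functions cannot be
orthogonal. -/
lemma eigenvalue_unique_Iio {β κ μ : ℝ} (hκ : κ ∈ eigenvalueSet β)
    (hμ : μ ∈ eigenvalueSet β) (hκ1 : κ < 1) (hμ1 : μ < 1) : κ = μ := by
  by_contra hne
  have h0 := integral_sinKernel_mul_eq_zero hκ hμ hne
  have : 0 < ∫ t in (0 : ℝ)..Real.pi, sinKernel κ t * sinKernel μ t :=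
    intervalIntegral.intervalIntegral_pos_of_pos_on
      (Continuous.intervalIntegrable (by fun_prop) _ _)
      (fun x hx => mul_pos (sinKernel_pos hκ1 hx.1 hx.2) (sinKernel_pos hμ1 hx.1 hx.2))
      Real.pi_pos
  linarith

lemma charFun_sq {β x : ℝ} (hx : 0 < x) : charFun β (x ^ 2) =
    Real.sin (x * Real.pi) / x * Real.cos β + Real.cos (x * Real.pi) * Real.sin β := by
  rw [charFun, sinKernel_of_pos (by positivity), cosSol_of_nonneg (by positivity),
    Real.sqrt_sq hx.le]

/-- At the squares of integers the `cos β` term drops out. Since `sin β > 0`, the signs alternate,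
which separates the eigenvalues. -/
lemma charFun_natCast_sq {β : ℝ} {n : ℕ} (hn : 1 ≤ n) :
    charFun β ((n : ℝ) ^ 2) = (-1) ^ n * Real.sin β := by
  rw [charFun_sq (by exact_mod_cast hn), Real.sin_nat_mul_pi, Real.cos_nat_mul_pi]
  ring

lemma sin_pos_of_mem {β : ℝ} (hβ : β ∈ Ioo 0 Real.pi) : 0 < Real.sin β :=
  Real.sin_pos_of_pos_of_lt_pi hβ.1 hβ.2

lemma exists_eigenvalue_Iio {β : ℝ} (hβ : β ∈ Ioo 0 Real.pi) :
    ∃ μ ∈ eigenvalueSet β, μ < 1 := by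
  have hs := sin_pos_of_mem hβ
  -- This choice gives `k sin β = 1 + sin β > 1`, so that `cosh (kπ) · k sin β` dominates `sinh (kπ)
  -- · cos β` whatever the sign of `cos β`.
  set k := 1 / Real.sin β + 1 with hk
  have hk0 : 0 < k := by positivity
  have h1 : charFun β 1 < 0 := by
    have := charFun_natCast_sq (β := β) (n := 1) le_rfl
    norm_num at this
    linarith
  have h2 : 0 < charFun β (-k ^ 2) := by
    have hneg : -k ^ 2 < 0 := by have := sq_pos_of_pos hk0; linarith
    rw [charFun, sinKernel_of_neg hneg, cosSol_of_nonpos hneg.le, neg_neg, Real.sqrt_sq hk0.le]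
    set S := Real.sinh (k * Real.pi)
    set C := Real.cosh (k * Real.pi)
    have hS : 0 ≤ S := Real.sinh_nonneg_iff.2 (by positivity)
    have hSC : S < C := Real.sinh_lt_cosh _
    have hkS : 1 < k * Real.sin β := by
      rw [hk]; field_simp; linarith
    have hc : -1 ≤ Real.cos β := Real.neg_one_le_cos β
    have h3 : S / k * Real.cos β + C * Real.sin β
        = (S * Real.cos β + C * (k * Real.sin β)) / k := by
      field_simp
    rw [h3]
    refine div_pos ?_ hk0
    nlinarith [mul_nonneg hS (by linarith : 0 ≤ Real.cos β + 1)]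
  obtain ⟨μ, hμ, h0⟩ := intermediate_value_Ioo' (by nlinarith : -k ^ 2 ≤ 1)
    (continuous_charFun β).continuousOn ⟨h1, h2⟩
  exact ⟨μ, mem_eigenvalueSet_iff.2 h0, hμ.2⟩

lemma exists_eigenvalue_Ioo {β : ℝ} (hβ : β ∈ Ioo 0 Real.pi) {n : ℕ} (hn : 1 ≤ n) :
    ∃ μ ∈ eigenvalueSet β, μ ∈ Ioo ((n : ℝ) ^ 2) ((n + 1 : ℝ) ^ 2) := by
  have hs := sin_pos_of_mem hβ
  have h1 := charFun_natCast_sq (β := β) hn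
  have h2 := charFun_natCast_sq (β := β) (n := n + 1) (by omega)
  push_cast at h2
  have hle : (n : ℝ) ^ 2 ≤ (n + 1 : ℝ) ^ 2 := by gcongr; linarith
  rcases neg_one_pow_eq_or ℝ n with h | h
  · rw [h] at h1
    rw [pow_succ (-1 : ℝ), h] at h2
    obtain ⟨μ, hμ, h0⟩ := intermediate_value_Ioo' hle (continuous_charFun β).continuousOn
      (show (0 : ℝ) ∈ _ from ⟨by linarith, by linarith⟩)
    exact ⟨μ, mem_eigenvalueSet_iff.2 h0, hμ⟩
  · rw [h] at h1
    rw [pow_succ (-1 : ℝ), h] at h2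
    obtain ⟨μ, hμ, h0⟩ := intermediate_value_Ioo hle (continuous_charFun β).continuousOn
      (show (0 : ℝ) ∈ _ from ⟨by linarith, by linarith⟩)
    exact ⟨μ, mem_eigenvalueSet_iff.2 h0, hμ⟩

lemma sin_mul_pi_ne_zero {n : ℕ} {x : ℝ} (hx : x ∈ Ioo (n : ℝ) (n + 1)) :
    Real.sin (x * Real.pi) ≠ 0 := by
  intro h
  obtain ⟨m, hm⟩ := Real.sin_eq_zero_iff.1 h
  have hxm : (m : ℝ) = x := mul_right_cancel₀ Real.pi_ne_zero hm
  rw [← hxm] at hx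
  have h1 : (n : ℤ) < m := by exact_mod_cast hx.1
  have h2 : m < (n : ℤ) + 1 := by exact_mod_cast hx.2
  omega

/-- Between consecutive integers the characteristic equation is `x cot (πx) = -cot β`, so
monotonicity gives uniqueness of the root. The numerator of the derivative is `sin (πx) cos (πx) -
πx`, which is negative since `πx > 1`. -/
lemma strictAntiOn_mul_cot {n : ℕ} (hn : 1 ≤ n) :
    StrictAntiOn (fun x : ℝ => x * Real.cos (x * Real.pi) / Real.sin (x * Real.pi))
      (Ioo (n : ℝ) (n + 1)) := by
  have hder : ∀ x ∈ Ioo (n : ℝ) (n + 1), HasDerivAt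
      (fun x : ℝ => x * Real.cos (x * Real.pi) / Real.sin (x * Real.pi))
      (((1 * Real.cos (x * Real.pi) + x * (-Real.sin (x * Real.pi) * (1 * Real.pi)))
        * Real.sin (x * Real.pi) - x * Real.cos (x * Real.pi)
        * (Real.cos (x * Real.pi) * (1 * Real.pi))) / Real.sin (x * Real.pi) ^ 2) x := by
    intro x hx
    have h1 := (hasDerivAt_id' x).mul_const Real.pi
    exact ((hasDerivAt_id' x).mul h1.cos).div h1.sin (sin_mul_pi_ne_zero hx)
  refine strictAntiOn_of_deriv_neg (convex_Ioo _ _)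
    (fun x hx => (hder x hx).continuousAt.continuousWithinAt) ?_
  rw [interior_Ioo]
  intro x hx
  rw [(hder x hx).deriv]
  have hs2 : 0 < Real.sin (x * Real.pi) ^ 2 := by
    have := sin_mul_pi_ne_zero hx
    positivity
  refine div_neg_of_neg_of_pos ?_ hs2
  have h1 := Real.sin_sq_add_cos_sq (x * Real.pi)
  have hx1 : 1 < x := lt_of_le_of_lt (by exact_mod_cast hn) hx.1
  have hpi := Real.pi_gt_three
  have hxpi : 1 < x * Real.pi := by nlinarith
  set S := Real.sin (x * Real.pi)
  set C := Real.cos (x * Real.pi)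
  have h2 : (1 * C + x * (-S * (1 * Real.pi))) * S - x * C * (C * (1 * Real.pi))
      = C * S - x * Real.pi := by linear_combination (-(x * Real.pi)) * h1
  rw [h2]
  nlinarith [sq_nonneg (S - C)]

lemma mul_cot_eq_of_eigenvalue {β : ℝ} (hβ : β ∈ Ioo 0 Real.pi) {n : ℕ} {μ : ℝ}
    (hμ : μ ∈ eigenvalueSet β) (hn : Real.sqrt μ ∈ Ioo (n : ℝ) (n + 1)) (h0 : 0 < μ) :
    Real.sqrt μ * Real.cos (Real.sqrt μ * Real.pi) / Real.sin (Real.sqrt μ * Real.pi)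
      = -(Real.cos β / Real.sin β) := by
  have hs := sin_pos_of_mem hβ
  have hsp := Real.sqrt_pos.2 h0
  have hne := sin_mul_pi_ne_zero hn
  rw [mem_eigenvalueSet_iff, ← Real.sq_sqrt h0.le, charFun_sq hsp] at hμ
  rw [div_eq_iff hne]
  field_simp at hμ ⊢
  linarith

lemma sqrt_mem_Ioo {n : ℕ} {μ : ℝ} (h : μ ∈ Ioo ((n : ℝ) ^ 2) ((n + 1 : ℝ) ^ 2)) :
    Real.sqrt μ ∈ Ioo (n : ℝ) (n + 1) :=
  ⟨Real.lt_sqrt_of_sq_lt h.1, (Real.sqrt_lt' (by positivity)).2 h.2⟩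

lemma eigenvalue_unique_Ioo {β κ μ : ℝ} (hβ : β ∈ Ioo 0 Real.pi) {n : ℕ} (hn : 1 ≤ n)
    (hκ : κ ∈ eigenvalueSet β) (hμ : μ ∈ eigenvalueSet β)
    (hκn : κ ∈ Ioo ((n : ℝ) ^ 2) ((n + 1 : ℝ) ^ 2))
    (hμn : μ ∈ Ioo ((n : ℝ) ^ 2) ((n + 1 : ℝ) ^ 2)) : κ = μ := by
  have hκ0 : 0 < κ := lt_of_le_of_lt (by positivity) hκn.1
  have hμ0 : 0 < μ := lt_of_le_of_lt (by positivity) hμn.1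
  have h := (strictAntiOn_mul_cot hn).injOn (sqrt_mem_Ioo hκn) (sqrt_mem_Ioo hμn)
    ((mul_cot_eq_of_eigenvalue hβ hκ (sqrt_mem_Ioo hκn) hκ0).trans
      (mul_cot_eq_of_eigenvalue hβ hμ (sqrt_mem_Ioo hμn) hμ0).symm)
  exact (Real.sqrt_inj hκ0.le hμ0.le).1 h

/-- The interval that contains the `n`-th eigenvalue. -/
def eigenvalueCell (n : ℕ) : Set ℝ :=
  if n = 0 then Iio 1 else Ioo ((n : ℝ) ^ 2) ((n + 1 : ℝ) ^ 2)

lemma lt_of_mem_cell {n : ℕ} {μ : ℝ} (h : μ ∈ eigenvalueCell n) : μ < (n + 1 : ℝ) ^ 2 := by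
  unfold eigenvalueCell at h
  split_ifs at h with h0
  · simpa [h0] using h
  · exact h.2

lemma lt_of_mem_cell_of_lt {m n : ℕ} {κ μ : ℝ} (hκ : κ ∈ eigenvalueCell m)
    (hμ : μ ∈ eigenvalueCell n) (hmn : m < n) : κ < μ := by
  have h1 := lt_of_mem_cell hκ
  unfold eigenvalueCell at hμ
  rw [if_neg (by omega)] at hμ
  have h2 : (m + 1 : ℝ) ≤ n := by exact_mod_cast hmn
  have h3 : (m + 1 : ℝ) ^ 2 ≤ (n : ℝ) ^ 2 := by gcongr
  linarith [hμ.1]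

lemma exists_mem_cell {β μ : ℝ} (hβ : β ∈ Ioo 0 Real.pi) (hμ : μ ∈ eigenvalueSet β) :
    ∃ n, μ ∈ eigenvalueCell n := by
  by_cases h1 : μ < 1
  · exact ⟨0, by simpa [eigenvalueCell] using h1⟩
  push Not at h1
  have hs1 : 1 ≤ Real.sqrt μ := Real.one_le_sqrt.2 h1
  have hfl : 1 ≤ ⌊Real.sqrt μ⌋₊ := Nat.le_floor (by exact_mod_cast hs1)
  have ha := Nat.floor_le (zero_le_one.trans hs1)
  have hb := Nat.lt_floor_add_one (Real.sqrt μ)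
  have hsq := Real.sq_sqrt (zero_le_one.trans h1)
  refine ⟨⌊Real.sqrt μ⌋₊, ?_⟩
  rw [eigenvalueCell, if_neg (by omega)]
  set n := ⌊Real.sqrt μ⌋₊
  refine ⟨lt_of_le_of_ne (by rw [← hsq]; gcongr) ?_, by rw [← hsq]; gcongr⟩
  -- The left endpoint is excluded because the characteristic function is `± sin β ≠ 0` there.
  intro h
  rw [mem_eigenvalueSet_iff, ← h, charFun_natCast_sq hfl] at hμ
  rcases neg_one_pow_eq_or ℝ n with h' | h' <;> rw [h'] at hμ <;>
    linarith [sin_pos_of_mem hβ]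

lemma exists_eigenvalue_cell {β : ℝ} (hβ : β ∈ Ioo 0 Real.pi) (n : ℕ) :
    ∃ μ ∈ eigenvalueSet β, μ ∈ eigenvalueCell n := by
  unfold eigenvalueCell
  split_ifs with h
  · exact exists_eigenvalue_Iio hβ
  · exact exists_eigenvalue_Ioo hβ (by omega)

lemma eigenvalue_unique_cell {β κ μ : ℝ} (hβ : β ∈ Ioo 0 Real.pi) {n : ℕ}
    (hκ : κ ∈ eigenvalueSet β) (hμ : μ ∈ eigenvalueSet β)
    (hκn : κ ∈ eigenvalueCell n) (hμn : μ ∈ eigenvalueCell n) : κ = μ := by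
  unfold eigenvalueCell at hκn hμn
  split_ifs at hκn hμn with h
  · exact eigenvalue_unique_Iio hκ hμ hκn hμn
  · exact eigenvalue_unique_Ioo hβ (by omega) hκ hμ hκn hμn

/-- The cells are ordered, contain one eigenvalue each and together contain all of them. Hence each
infimum in the definition is an attained minimum, not a default value of `sInf`. -/
lemma freeEigenvalue_mem {β : ℝ} (hβ : β ∈ Ioo 0 Real.pi) (n : ℕ) :
    freeEigenvalue β n ∈ eigenvalueSet β ∧ freeEigenvalue β n ∈ eigenvalueCell n := by
  induction n with
  | zero =>
    obtain ⟨e, he, hec⟩ := exists_eigenvalue_cell hβ 0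
    have hleast : IsLeast (eigenvalueSet β) e := by
      refine ⟨he, fun μ hμ => ?_⟩
      obtain ⟨m, hm⟩ := exists_mem_cell hβ hμ
      rcases Nat.eq_zero_or_pos m with rfl | hpos
      · exact (eigenvalue_unique_cell hβ he hμ hec hm).le
      · exact (lt_of_mem_cell_of_lt hec hm hpos).le
    rw [freeEigenvalue, hleast.csInf_eq]
    exact ⟨he, hec⟩
  | succ n ih =>
    obtain ⟨e, he, hec⟩ := exists_eigenvalue_cell hβ (n + 1)
    have hleast : IsLeast {μ ∈ eigenvalueSet β | freeEigenvalue β n < μ} e := by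
      refine ⟨⟨he, lt_of_mem_cell_of_lt ih.2 hec (by omega)⟩, fun μ hμ => ?_⟩
      obtain ⟨m, hm⟩ := exists_mem_cell hβ hμ.1
      rcases lt_trichotomy m (n + 1) with h | rfl | h
      · exfalso
        rcases (show m < n ∨ m = n by omega) with h' | rfl
        · exact lt_asymm hμ.2 (lt_of_mem_cell_of_lt hm ih.2 h')
        · exact hμ.2.ne (eigenvalue_unique_cell hβ ih.1 hμ.1 ih.2 hm)
      · exact (eigenvalue_unique_cell hβ he hμ.1 hec hm).le
      · exact (lt_of_mem_cell_of_lt hec hm h).le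
    rw [freeEigenvalue, hleast.csInf_eq]
    exact ⟨he, hec⟩

lemma freeEigenvalue_injective {β : ℝ} (hβ : β ∈ Ioo 0 Real.pi) :
    Function.Injective (freeEigenvalue β) := by
  refine StrictMono.injective (strictMono_nat_of_lt_succ fun n => ?_)
  exact lt_of_mem_cell_of_lt (freeEigenvalue_mem hβ n).2 (freeEigenvalue_mem hβ (n + 1)).2
    (by omega)

lemma freq_eq_sqrt (β : ℝ) (n : ℕ) : freq β n = Real.sqrt (freeEigenvalue β n) := by
  rw [freq, delta]; ring

lemma freeEigenvalue_pos {β : ℝ} (hβ : β ∈ Ioo 0 Real.pi) {n : ℕ} (hn : 1 ≤ n) :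
    0 < freeEigenvalue β n := by
  have h := (freeEigenvalue_mem hβ n).2
  rw [eigenvalueCell, if_neg (by omega)] at h
  exact lt_of_le_of_lt (by positivity) h.1

lemma freq_mem_Ioo {β : ℝ} (hβ : β ∈ Ioo 0 Real.pi) {n : ℕ} (hn : 1 ≤ n) :
    freq β n ∈ Ioo (n : ℝ) (n + 1) := by
  have h := (freeEigenvalue_mem hβ n).2
  rw [eigenvalueCell, if_neg (by omega)] at h
  rw [freq_eq_sqrt]
  exact sqrt_mem_Ioo h

lemma freq_sq {β : ℝ} (hβ : β ∈ Ioo 0 Real.pi) {n : ℕ} (hn : 1 ≤ n) :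
    freq β n ^ 2 = freeEigenvalue β n := by
  rw [freq_eq_sqrt, Real.sq_sqrt (freeEigenvalue_pos hβ hn).le]

/-- The eigenvalue equation reads `f cos (fπ) = -cot β · sin (fπ)` with `f = freq β n > n`. -/
lemma abs_cos_freq_mul_pi_le {β : ℝ} (hβ : β ∈ Ioo 0 Real.pi) {n : ℕ} (hn : 1 ≤ n) :
    |Real.cos (freq β n * Real.pi)| ≤ |Real.cos β / Real.sin β| / n := by
  have hn0 : (0 : ℝ) < n := by exact_mod_cast hn
  have hf := freq_mem_Ioo hβ hn
  have hf0 : 0 < freq β n := hn0.trans hf.1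
  have h := mul_cot_eq_of_eigenvalue hβ (freeEigenvalue_mem hβ n).1
    (by rw [← freq_eq_sqrt]; exact hf) (freeEigenvalue_pos hβ hn)
  rw [← freq_eq_sqrt, div_eq_iff (sin_mul_pi_ne_zero hf)] at h
  rw [le_div_iff₀ hn0]
  calc |Real.cos (freq β n * Real.pi)| * n ≤ |Real.cos (freq β n * Real.pi)| * freq β n := by
        gcongr; exact hf.1.le
    _ = |freq β n * Real.cos (freq β n * Real.pi)| := by
        rw [abs_mul, abs_of_pos hf0, mul_comm]
    _ = |Real.cos β / Real.sin β| * |Real.sin (freq β n * Real.pi)| := by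
        rw [h, abs_mul, abs_neg]
    _ ≤ |Real.cos β / Real.sin β| * 1 := by gcongr; exact Real.abs_sin_le_one _
    _ = _ := mul_one _

lemma abs_freq_sub_le {β : ℝ} (hβ : β ∈ Ioo 0 Real.pi) {n : ℕ} (hn : 1 ≤ n) :
    |freq β n - (n + 1 / 2)| ≤ |Real.cos β / Real.sin β| / n := by
  refine le_trans ?_ (abs_cos_freq_mul_pi_le hβ hn)
  have hf := freq_mem_Ioo hβ hn
  set ε := freq β n - (n + 1 / 2) with hε
  have hεb : |ε| ≤ 1 / 2 := by rw [abs_le]; constructor <;> linarith [hf.1, hf.2]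
  have hfe : freq β n * Real.pi = (ε * Real.pi + Real.pi / 2) + n * Real.pi := by rw [hε]; ring
  have h1 : |Real.cos (freq β n * Real.pi)| = |Real.sin (ε * Real.pi)| := by
    rw [hfe, Real.cos_add_nat_mul_pi, abs_mul, abs_pow, abs_neg, abs_one, one_pow, one_mul,
      Real.cos_add_pi_div_two, abs_neg]
  rw [h1, Real.abs_sin_eq_sin_abs_of_abs_le_pi, abs_mul, abs_of_pos Real.pi_pos]
  · have h2 := Real.mul_le_sin (x := |ε| * Real.pi) (by positivity)
      (by nlinarith [Real.pi_pos])
    have h3 : 2 / Real.pi * (|ε| * Real.pi) = 2 * |ε| := by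
      have := Real.pi_ne_zero
      field_simp
    rw [h3] at h2
    linarith [abs_nonneg ε]
  · rw [abs_mul, abs_of_pos Real.pi_pos]
    nlinarith [Real.pi_pos]

lemma freeNorming_mul_freq_sq {β : ℝ} (hβ : β ∈ Ioo 0 Real.pi) {n : ℕ} (hn : 1 ≤ n) :
    freeNorming β n * freq β n ^ 2 = Real.pi / 2
      - Real.sin (freq β n * Real.pi) * Real.cos (freq β n * Real.pi) / (2 * freq β n) := by
  have hn0 : (0 : ℝ) < n := by exact_mod_cast hn
  have hf0 : 0 < freq β n := hn0.trans (freq_mem_Ioo hβ hn).1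
  have h1 : ∀ x, sinKernel (freeEigenvalue β n) x ^ 2
      = Real.sin (freq β n * x) ^ 2 * (1 / freq β n ^ 2) := fun x => by
    rw [sinKernel_of_pos (freeEigenvalue_pos hβ hn), ← freq_eq_sqrt]; ring
  rw [freeNorming]
  simp_rw [h1]
  rw [intervalIntegral.integral_mul_const,
    intervalIntegral.integral_comp_mul_left (fun y => Real.sin y ^ 2) hf0.ne', integral_sin_sq]
  simp
  field_simp
  ring

/-- The error `sin · cos / (2f)` is `O(1/n²)` rather than `O(1/n)`, because `cos (fπ)` is itself
`O(1/n)`. -/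
lemma abs_freeNorming_sub_le {β : ℝ} (hβ : β ∈ Ioo 0 Real.pi) {n : ℕ} (hn : 1 ≤ n) :
    |freeNorming β n * freq β n ^ 2 - Real.pi / 2| ≤ |Real.cos β / Real.sin β| / n ^ 2 := by
  have hn0 : (0 : ℝ) < n := by exact_mod_cast hn
  have hf := (freq_mem_Ioo hβ hn).1
  have hf0 : 0 < freq β n := hn0.trans hf
  rw [freeNorming_mul_freq_sq hβ hn, sub_sub_cancel_left, abs_neg, abs_div, abs_mul,
    abs_of_pos (by positivity : 0 < 2 * freq β n)]
  have h2 := abs_cos_freq_mul_pi_le hβ hn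
  calc _ ≤ 1 * (|Real.cos β / Real.sin β| / n) / n := by
        gcongr
        · exact Real.abs_sin_le_one _
        · linarith
    _ = _ := by field_simp

/-! ### Square-integrable functions -/

lemma inner_toLp {α : Type*} [MeasurableSpace α] {ν : Measure α} {f g : α → ℝ}
    (hf : MemLp f 2 ν) (hg : MemLp g 2 ν) :
    inner ℝ (hf.toLp f) (hg.toLp g) = ∫ x, f x * g x ∂ν := by
  rw [L2.inner_def]
  refine integral_congr_ae ?_
  filter_upwards [hf.coeFn_toLp, hg.coeFn_toLp] with x h1 h2
  rw [h1, h2]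
  simp [mul_comm]

lemma integrable_mul_of_memLp {α : Type*} [MeasurableSpace α] {ν : Measure α} {f g : α → ℝ}
    (hf : MemLp f 2 ν) (hg : MemLp g 2 ν) : Integrable (fun x => f x * g x) ν :=
  hf.integrable_mul hg

lemma sq_integral_mul_le {α : Type*} [MeasurableSpace α] {ν : Measure α} {f g : α → ℝ}
    (hf : MemLp f 2 ν) (hg : MemLp g 2 ν) :
    (∫ x, f x * g x ∂ν) ^ 2 ≤ (∫ x, f x ^ 2 ∂ν) * ∫ x, g x ^ 2 ∂ν := by
  have h := real_inner_mul_inner_self_le (hf.toLp f) (hg.toLp g)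
  simp only [inner_toLp] at h
  simpa only [sq] using h

lemma ae_eq_zero_of_integral_sq {α : Type*} [MeasurableSpace α] {ν : Measure α} {f : α → ℝ}
    (hf : MemLp f 2 ν) (h : ∫ x, f x ^ 2 ∂ν ≤ 0) : f =ᵐ[ν] 0 := by
  have h0 : ∫ x, f x ^ 2 ∂ν = 0 := le_antisymm h (integral_nonneg fun x => sq_nonneg _)
  have h1 := (integral_eq_zero_iff_of_nonneg (fun x => sq_nonneg (f x)) hf.integrable_sq).1 h0
  filter_upwards [h1] with x hx
  simpa using hx

lemma memLp_of_continuous {f : ℝ → ℝ} (hf : Continuous f) (a b : ℝ) :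
    MemLp f 2 (volume.restrict (Ioc a b)) := by
  obtain ⟨C, hC⟩ := isCompact_Icc.exists_bound_of_continuousOn (hf.continuousOn (s := Icc a b))
  exact MemLp.of_bound hf.aestronglyMeasurable C
    ((ae_restrict_iff' measurableSet_Ioc).2 (Eventually.of_forall fun x hx =>
      hC x (Ioc_subset_Icc_self hx)))

/-! ### The system `sin ((n + 1/2) t)` -/

/-- Multiplication by `cos t` maps the span of the system into itself: it averages the two
neighbouring sines. For `n = 0` the lower neighbour is `sin (-t/2) = -sin (t/2)`, again a member up
to sign. -/
lemma integral_mul_sin_mul_cos_pow {p : ℝ → ℝ} (hp : MemLp p 2 (volume.restrict (Ioc 0 Real.pi)))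
    (h : ∀ n : ℕ, ∫ t in (0 : ℝ)..Real.pi, p t * Real.sin ((n + 1 / 2) * t) = 0) (k : ℕ) :
    ∀ n : ℕ, ∫ t in (0 : ℝ)..Real.pi, p t * (Real.sin ((n + 1 / 2) * t) * Real.cos t ^ k)
      = 0 := by
  have hint : ∀ g : ℝ → ℝ, Continuous g →
      IntervalIntegrable (fun t => p t * g t) volume 0 Real.pi := fun g hg => by
    rw [intervalIntegrable_iff_integrableOn_Ioc_of_le Real.pi_pos.le]
    exact integrable_mul_of_memLp hp (memLp_of_continuous hg _ _)
  induction k with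
  | zero => simpa using h
  | succ k ih =>
    intro n
    rcases n with _ | n
    · have e : ∀ t, p t * (Real.sin (((0 : ℕ) + 1 / 2) * t) * Real.cos t ^ (k + 1))
          = 1 / 2 * (p t * (Real.sin (((1 : ℕ) + 1 / 2) * t) * Real.cos t ^ k))
          - 1 / 2 * (p t * (Real.sin (((0 : ℕ) + 1 / 2) * t) * Real.cos t ^ k)) := fun t => by
        have h1 : (((1 : ℕ) : ℝ) + 1 / 2) * t = ((0 : ℕ) + 1 / 2 : ℝ) * t + t := by
          push_cast; ring
        have h2 : Real.sin (((0 : ℕ) + 1 / 2 : ℝ) * t)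
            = -(Real.sin (((0 : ℕ) + 1 / 2 : ℝ) * t) * Real.cos t
              - Real.cos (((0 : ℕ) + 1 / 2 : ℝ) * t) * Real.sin t) := by
          rw [← Real.sin_sub, ← Real.sin_neg]
          congr 1
          push_cast; ring
        rw [h1, Real.sin_add]
        linear_combination (1 / 2 * p t * Real.cos t ^ k) * h2
      simp_rw [e]
      rw [intervalIntegral.integral_sub, intervalIntegral.integral_const_mul,
        intervalIntegral.integral_const_mul, ih, ih]
      · simp
      all_goals exact (hint _ (by fun_prop)).const_mul _
    · have e : ∀ t, p t * (Real.sin (((n + 1 : ℕ) + 1 / 2) * t) * Real.cos t ^ (k + 1))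
          = 1 / 2 * (p t * (Real.sin (((n + 2 : ℕ) + 1 / 2) * t) * Real.cos t ^ k))
          + 1 / 2 * (p t * (Real.sin ((n + 1 / 2) * t) * Real.cos t ^ k)) := fun t => by
        have h1 : (((n + 2 : ℕ) : ℝ) + 1 / 2) * t = ((n + 1 : ℕ) + 1 / 2 : ℝ) * t + t := by
          push_cast; ring
        have h2 : ((n : ℝ) + 1 / 2) * t = ((n + 1 : ℕ) + 1 / 2 : ℝ) * t - t := by
          push_cast; ring
        rw [h1, h2, Real.sin_add, Real.sin_sub]
        ring
      simp_rw [e]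
      rw [intervalIntegral.integral_add, intervalIntegral.integral_const_mul,
        intervalIntegral.integral_const_mul, ih, ih]
      · simp
      all_goals exact (hint _ (by fun_prop)).const_mul _

/-- Weierstrass approximation of `g` on `[u, v]`, with `w` as an integrable weight. -/
lemma integral_mul_eq_zero_of_moments {w : ℝ → ℝ} {a b : ℝ} {c : ℝ → ℝ} {u v : ℝ}
    (hc : Continuous c) (hcm : ∀ t ∈ Ioc a b, c t ∈ Icc u v)
    (hw : Integrable w (volume.restrict (Ioc a b)))
    (h : ∀ k : ℕ, ∫ t in Ioc a b, w t * c t ^ k = 0) {g : ℝ → ℝ}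
    (hg : ContinuousOn g (Icc u v)) : ∫ t in Ioc a b, w t * g (c t) = 0 := by
  have hbd : ∀ f : ℝ → ℝ, ContinuousOn f (Icc u v) →
      Integrable (fun t => w t * f (c t)) (volume.restrict (Ioc a b)) := by
    intro f hf
    obtain ⟨C, hC⟩ := isCompact_Icc.exists_bound_of_continuousOn hf
    refine hw.mul_bdd (c := C) ?_ ?_
    · exact (hf.comp hc.continuousOn hcm).aestronglyMeasurable measurableSet_Ioc
    · exact (ae_restrict_iff' measurableSet_Ioc).2 (Eventually.of_forall fun x hx =>
        hC _ (hcm x hx))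
  have hpoly : ∀ P : Polynomial ℝ, ∫ t in Ioc a b, w t * P.eval (c t) = 0 := by
    intro P
    induction P using Polynomial.induction_on' with
    | add P Q hP hQ =>
      simp_rw [Polynomial.eval_add, mul_add]
      rw [integral_add (hbd _ P.continuous.continuousOn) (hbd _ Q.continuous.continuousOn), hP,
        hQ, add_zero]
    | monomial k x =>
      simp_rw [Polynomial.eval_monomial, mul_left_comm _ x]
      rw [integral_const_mul, h, mul_zero]
  refine abs_eq_zero.1 (le_antisymm (le_of_forall_pos_le_add fun ε hε => ?_) (abs_nonneg _))
  have hI : 0 ≤ ∫ t in Ioc a b, |w t| := integral_nonneg fun _ => abs_nonneg _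
  -- The summand `1` keeps the denominator positive when `w` vanishes almost everywhere.
  obtain ⟨P, hP⟩ := exists_polynomial_near_of_continuousOn u v g hg
    (ε / ((∫ t in Ioc a b, |w t|) + 1)) (by positivity)
  have hdiff : ∫ t in Ioc a b, w t * g (c t) = ∫ t in Ioc a b, w t * (g (c t) - P.eval (c t)) := by
    simp_rw [mul_sub]
    rw [integral_sub (hbd _ hg) (hbd _ P.continuous.continuousOn), hpoly, sub_zero]
  rw [hdiff, zero_add, ← Real.norm_eq_abs]
  calc _ ≤ ∫ t in Ioc a b, |w t| * (ε / ((∫ t in Ioc a b, |w t|) + 1)) := by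
        refine norm_integral_le_of_norm_le (hw.abs.mul_const _) ?_
        refine (ae_restrict_iff' measurableSet_Ioc).2 (Eventually.of_forall fun x hx => ?_)
        rw [norm_mul, Real.norm_eq_abs, Real.norm_eq_abs, abs_sub_comm]
        gcongr
        exact (hP _ (hcm x hx)).le
    _ = (∫ t in Ioc a b, |w t|) * (ε / ((∫ t in Ioc a b, |w t|) + 1)) :=
        integral_mul_const _ _
    _ ≤ ε := by
        rw [mul_div_assoc', div_le_iff₀ (by positivity)]
        nlinarith

/-- All moments of `w = p · sin (t/2)` against powers of `cos t` vanish. On `[0, π]` every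
continuous function is a continuous function of `cos t`, through `arccos`, so `w = 0`; and `sin
(t/2) > 0` there. -/
lemma ae_eq_zero_of_integral_mul_sin_half {p : ℝ → ℝ}
    (hp : MemLp p 2 (volume.restrict (Ioc 0 Real.pi)))
    (h : ∀ n : ℕ, ∫ t in (0 : ℝ)..Real.pi, p t * Real.sin ((n + 1 / 2) * t) = 0) :
    p =ᵐ[volume.restrict (Ioc 0 Real.pi)] 0 := by
  set w : ℝ → ℝ := fun t => p t * Real.sin (((0 : ℕ) + 1 / 2) * t) with hw
  have hwint : Integrable w (volume.restrict (Ioc 0 Real.pi)) :=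
    integrable_mul_of_memLp hp (memLp_of_continuous (by fun_prop) _ _)
  have hmom : ∀ k : ℕ, ∫ t in Ioc 0 Real.pi, w t * Real.cos t ^ k = 0 := fun k => by
    have := integral_mul_sin_mul_cos_pow hp h k 0
    rw [intervalIntegral.integral_of_le Real.pi_pos.le] at this
    simpa only [hw, mul_assoc] using this
  have hw0 : ∀ᵐ t ∂(volume.restrict (Ioc 0 Real.pi)), w t = 0 := by
    refine ae_eq_zero_of_integral_contDiff_smul_eq_zero hwint.locallyIntegrable ?_
    intro g hg _
    have := integral_mul_eq_zero_of_moments (g := fun y => g (Real.arccos y)) (u := -1) (v := 1)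
      Real.continuous_cos (fun t _ => Real.cos_mem_Icc t) hwint hmom
      (hg.continuous.comp Real.continuous_arccos).continuousOn
    refine Eq.trans ?_ this
    refine setIntegral_congr_fun measurableSet_Ioc fun t ht => ?_
    simp only [smul_eq_mul]
    rw [Real.arccos_cos ht.1.le ht.2, mul_comm]
  filter_upwards [hw0, ae_restrict_mem measurableSet_Ioc] with t ht hmem
  refine (mul_eq_zero.1 ht).resolve_right (Real.sin_pos_of_pos_of_lt_pi ?_ ?_).ne'
  · push_cast; linarith [hmem.1]
  · push_cast; linarith [hmem.2, Real.pi_pos]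

lemma integral_sin_half_mul (m n : ℕ) :
    ∫ t in (0 : ℝ)..Real.pi, Real.sin ((m + 1 / 2) * t) * Real.sin ((n + 1 / 2) * t)
      = if m = n then Real.pi / 2 else 0 := by
  have h1 : ∀ k : ℤ, k ≠ 0 → ∫ t in (0 : ℝ)..Real.pi, Real.cos (k * t) = 0 := by
    intro k hk
    rw [intervalIntegral.integral_comp_mul_left (fun y => Real.cos y) (by exact_mod_cast hk)]
    simp [Real.sin_int_mul_pi]
  have e : ∀ t : ℝ, Real.sin ((m + 1 / 2) * t) * Real.sin ((n + 1 / 2) * t)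
      = 1 / 2 * Real.cos (((m - n : ℤ) : ℝ) * t) - 1 / 2 * Real.cos (((m + n + 1 : ℤ) : ℝ) * t) := by
    intro t
    have h1 : ((m - n : ℤ) : ℝ) * t = (m + 1 / 2) * t - (n + 1 / 2) * t := by push_cast; ring
    have h2 : ((m + n + 1 : ℤ) : ℝ) * t = (m + 1 / 2) * t + (n + 1 / 2) * t := by push_cast; ring
    rw [h1, h2, Real.cos_sub, Real.cos_add]
    ring
  simp_rw [e]
  rw [intervalIntegral.integral_sub (Continuous.intervalIntegrable (by fun_prop) _ _)
    (Continuous.intervalIntegrable (by fun_prop) _ _), intervalIntegral.integral_const_mul,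
    intervalIntegral.integral_const_mul, h1 (m + n + 1) (by omega)]
  split_ifs with hmn
  · subst hmn
    simp
    ring
  · rw [h1 _ (by omega)]
    simp

/-- Parseval's identity for the system `sin ((n + 1/2) t)` on `[0, π]`. -/
lemma hasSum_sq_integral_mul_sin_half {p : ℝ → ℝ}
    (hp : MemLp p 2 (volume.restrict (Ioc 0 Real.pi))) :
    HasSum (fun n : ℕ => 2 / Real.pi *
        (∫ t in (0 : ℝ)..Real.pi, p t * Real.sin ((n + 1 / 2) * t)) ^ 2)
      (∫ t in (0 : ℝ)..Real.pi, p t ^ 2) := by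
  have hpi := Real.pi_pos
  set c := Real.sqrt (2 / Real.pi) with hc
  have hc2 : c ^ 2 = 2 / Real.pi := Real.sq_sqrt (by positivity)
  have hmem : ∀ n : ℕ, MemLp (fun t => c * Real.sin ((n + 1 / 2) * t)) 2
      (volume.restrict (Ioc 0 Real.pi)) := fun n => memLp_of_continuous (by fun_prop) _ _
  set e : ℕ → Lp ℝ 2 (volume.restrict (Ioc 0 Real.pi)) := fun n => (hmem n).toLp _ with he
  have hin : ∀ (q : ℝ → ℝ) (hq : MemLp q 2 (volume.restrict (Ioc 0 Real.pi))) (n : ℕ),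
      inner ℝ (hq.toLp q) (e n)
        = c * ∫ t in (0 : ℝ)..Real.pi, q t * Real.sin ((n + 1 / 2) * t) := by
    intro q hq n
    rw [he, inner_toLp, ← intervalIntegral.integral_of_le hpi.le,
      ← intervalIntegral.integral_const_mul]
    congr 1
    ext t
    ring
  have hon : Orthonormal ℝ e := by
    rw [orthonormal_iff_ite]
    intro m n
    rw [show e m = (hmem m).toLp _ from rfl, hin]
    simp_rw [mul_assoc]
    rw [intervalIntegral.integral_const_mul, integral_sin_half_mul]
    split_ifs
    · rw [← mul_assoc, ← sq, hc2]
      field_simp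
    · simp
  have hbot : (Submodule.span ℝ (Set.range e))ᗮ = ⊥ := by
    rw [Submodule.eq_bot_iff]
    intro x hx
    have hx' : MemLp (x : ℝ → ℝ) 2 (volume.restrict (Ioc 0 Real.pi)) := Lp.memLp x
    rw [Submodule.mem_orthogonal'] at hx
    have h0 := ae_eq_zero_of_integral_mul_sin_half hx' fun n => by
      have h1 := hx (e n) (Submodule.subset_span ⟨n, rfl⟩)
      rw [← Lp.toLp_coeFn x hx', hin] at h1
      exact (mul_eq_zero.1 h1).resolve_left (Real.sqrt_pos.2 (by positivity)).ne'
    exact (Lp.eq_zero_iff_ae_eq_zero).2 h0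
  have hsum := (HilbertBasis.mkOfOrthogonalEqBot hon hbot).hasSum_inner_mul_inner
    (hp.toLp p) (hp.toLp p)
  simp only [HilbertBasis.coe_mkOfOrthogonalEqBot] at hsum
  rw [inner_toLp, ← intervalIntegral.integral_of_le hpi.le] at hsum
  simp_rw [fun n => real_inner_comm (hp.toLp p) (e n), hin, ← sq] at hsum
  simpa only [mul_pow, hc2, ← sq] using hsum

/-! ### Completeness of systems of solutions -/

/-- The functions `sin (√κ t) / √κ`, `κ ∈ K`, are complete in `L²(0, π)`. -/
def IsCompleteSystem (K : Set ℝ) : Prop :=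
  ∀ p : ℝ → ℝ, MemLp p 2 (volume.restrict (Ioc 0 Real.pi)) →
    (∀ κ ∈ K, ∫ t in (0 : ℝ)..Real.pi, p t * sinKernel κ t = 0) →
    p =ᵐ[volume.restrict (Ioc 0 Real.pi)] 0

lemma IsCompleteSystem.mono {K K' : Set ℝ} (h : IsCompleteSystem K) (hK : K ⊆ K') :
    IsCompleteSystem K' :=
  fun p hp h0 => h p hp fun κ hκ => h0 κ (hK hκ)

lemma integral_mul_sin_eq_zero {p : ℝ → ℝ} {x : ℝ} (hx : 0 < x)
    (h : ∫ t in (0 : ℝ)..Real.pi, p t * sinKernel (x ^ 2) t = 0) :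
    ∫ t in (0 : ℝ)..Real.pi, p t * Real.sin (x * t) = 0 := by
  have e : ∀ t, p t * Real.sin (x * t) = x * (p t * sinKernel (x ^ 2) t) := fun t => by
    rw [sinKernel_of_pos (by positivity), Real.sqrt_sq hx.le]
    field_simp
  simp_rw [e]
  rw [intervalIntegral.integral_const_mul, h, mul_zero]

/-- A system that is quadratically close to `sin ((n + 1/2) t)` becomes complete after replacing
finitely many of its members. -/
lemma exists_isCompleteSystem_tail {lam : ℕ → ℝ} {C : ℝ} {N₀ : ℕ}
    (hpos : ∀ n, N₀ ≤ n → 0 < lam n)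
    (hlam : ∀ n, N₀ ≤ n → |lam n - (n + 1 / 2)| ≤ C / n) :
    ∃ N, N₀ ≤ N ∧ IsCompleteSystem
      ((fun n : ℕ => ((n : ℝ) + 1 / 2) ^ 2) '' Iio N ∪ (fun n => lam n ^ 2) '' Ici N) := by
  have hpi := Real.pi_pos
  -- By Parseval and Cauchy–Schwarz, a `p` orthogonal to the mixed system satisfies `∫ p² ≤ (∫ p²)
  -- ∑_{n ≥ N} b n`, where `b n` comes from the uniform bound `Cπ/n` on the difference of the sines.
  -- A tail sum below `1` then forces `∫ p² = 0`.
  set b : ℕ → ℝ := fun n => 2 / Real.pi * (Real.pi * (C / n * Real.pi) ^ 2) with hb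
  have hbs : Summable b := by
    have : b = fun n : ℕ => 2 * Real.pi ^ 2 * C ^ 2 * (1 / (n : ℝ) ^ 2) := by
      ext n
      rw [hb]
      field_simp
    rw [this]
    exact (Real.summable_one_div_nat_pow.2 one_lt_two).mul_left _
  obtain ⟨N, hN, hN1⟩ : ∃ N, N₀ ≤ N ∧ ∑' k, b (k + N) < 1 :=
    (((tendsto_order.1 (tendsto_sum_nat_add b)).2 1 one_pos).and
      (eventually_ge_atTop N₀)).exists.imp fun _ h => ⟨h.2, h.1⟩
  refine ⟨N, hN, fun p hp h0 => ?_⟩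
  set a : ℕ → ℝ := fun n => 2 / Real.pi *
    (∫ t in (0 : ℝ)..Real.pi, p t * Real.sin ((n + 1 / 2) * t)) ^ 2 with ha
  have hsum : HasSum a (∫ t in (0 : ℝ)..Real.pi, p t ^ 2) := hasSum_sq_integral_mul_sin_half hp
  set I := ∫ t in (0 : ℝ)..Real.pi, p t ^ 2 with hI
  have hsmall : ∀ n, n < N → a n = 0 := fun n hn => by
    have := integral_mul_sin_eq_zero (by positivity) (h0 _ (Or.inl ⟨n, hn, rfl⟩))
    simp only [ha, this]
    simp
  have hlarge : ∀ n, N ≤ n → a n ≤ I * b n := fun n hn => by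
    have h1 := integral_mul_sin_eq_zero (hpos n (hN.trans hn)) (h0 _ (Or.inr ⟨n, hn, rfl⟩))
    have h2 : ∫ t in (0 : ℝ)..Real.pi, p t * Real.sin ((n + 1 / 2) * t)
        = ∫ t in (0 : ℝ)..Real.pi, p t * (Real.sin ((n + 1 / 2) * t) - Real.sin (lam n * t)) := by
      simp_rw [mul_sub]
      rw [intervalIntegral.integral_sub, h1, sub_zero] <;>
        rw [intervalIntegrable_iff_integrableOn_Ioc_of_le hpi.le] <;>
        exact integrable_mul_of_memLp hp (memLp_of_continuous (by fun_prop) _ _)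
    have h3 : (∫ t in (0 : ℝ)..Real.pi,
        p t * (Real.sin ((n + 1 / 2) * t) - Real.sin (lam n * t))) ^ 2
        ≤ I * ∫ t in (0 : ℝ)..Real.pi,
          (Real.sin ((n + 1 / 2) * t) - Real.sin (lam n * t)) ^ 2 := by
      rw [hI]
      simp only [intervalIntegral.integral_of_le hpi.le]
      exact sq_integral_mul_le hp (memLp_of_continuous (by fun_prop) _ _)
    have h4 : ∫ t in (0 : ℝ)..Real.pi, (Real.sin ((n + 1 / 2) * t) - Real.sin (lam n * t)) ^ 2
        ≤ ∫ _ in (0 : ℝ)..Real.pi, (C / n * Real.pi) ^ 2 := by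
      refine intervalIntegral.integral_mono_on hpi.le
        (Continuous.intervalIntegrable (by fun_prop) _ _)
        (Continuous.intervalIntegrable (by fun_prop) _ _) fun t ht => ?_
      rw [← sq_abs]
      gcongr
      have h5 : |Real.sin ((n + 1 / 2) * t) - Real.sin (lam n * t)|
          ≤ |(n + 1 / 2) * t - lam n * t| := by
        have := Real.lipschitzWith_sin.dist_le_mul ((n + 1 / 2) * t) (lam n * t)
        simpa [Real.dist_eq] using this
      refine h5.trans ?_
      rw [← sub_mul, abs_mul, abs_sub_comm, abs_of_nonneg ht.1]
      exact mul_le_mul (hlam n (hN.trans hn)) ht.2 ht.1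
        ((abs_nonneg _).trans (hlam n (hN.trans hn)))
    rw [intervalIntegral.integral_const, smul_eq_mul, sub_zero] at h4
    have hI0 : 0 ≤ I := intervalIntegral.integral_nonneg hpi.le fun _ _ => sq_nonneg _
    rw [ha, hb]
    simp only
    rw [h2]
    calc _ ≤ 2 / Real.pi * (I * (Real.pi * (C / n * Real.pi) ^ 2)) := by
          gcongr
          exact h3.trans (by gcongr)
      _ = _ := by ring
  have hI0 : 0 ≤ I := intervalIntegral.integral_nonneg hpi.le fun _ _ => sq_nonneg _
  have hI1 : I ≤ I * ∑' k, b (k + N) := by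
    have h1 := hsum.summable.sum_add_tsum_nat_add N
    rw [Finset.sum_eq_zero (fun n hn => hsmall n (Finset.mem_range.1 hn)), zero_add,
      hsum.tsum_eq] at h1
    rw [← tsum_mul_left]
    calc I = ∑' k, a (k + N) := h1.symm
      _ ≤ _ := Summable.tsum_le_tsum (fun k => hlarge _ (by omega))
        ((summable_nat_add_iff N).2 hsum.summable)
        (((summable_nat_add_iff N).2 hbs).mul_left _)
  refine ae_eq_zero_of_integral_sq hp ?_
  rw [← intervalIntegral.integral_of_le hpi.le]
  nlinarith

/-! ### Exchanging members of a complete system -/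

/-- The solution of `r'' + μ r = -p`, `r(b) = r'(b) = 0`. -/
def backwardSolution (μ b : ℝ) (p : ℝ → ℝ) (t : ℝ) : ℝ :=
  -∫ s in Ioc 0 b, if t < s then sinKernel μ (s - t) * p s else 0

lemma exists_bound_sinKernel (μ b : ℝ) : ∃ M, 0 ≤ M ∧ ∀ t ∈ Icc 0 b, |sinKernel μ t| ≤ M := by
  obtain ⟨C, hC⟩ := isCompact_Icc.exists_bound_of_continuousOn
    ((by fun_prop : Continuous fun t => sinKernel μ t).continuousOn (s := Icc 0 b))
  exact ⟨max C 0, le_max_right _ _, fun t ht => (hC t ht).trans (le_max_left _ _)⟩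

lemma aestronglyMeasurable_backwardKernel {μ b : ℝ} {p : ℝ → ℝ}
    (hp : Integrable p (volume.restrict (Ioc 0 b))) :
    AEStronglyMeasurable (fun z : ℝ × ℝ => if z.1 < z.2 then sinKernel μ (z.2 - z.1) * p z.2 else 0)
      ((volume.restrict (Ioc 0 b)).prod (volume.restrict (Ioc 0 b))) := by
  have h1 : AEStronglyMeasurable (fun z : ℝ × ℝ => sinKernel μ (z.2 - z.1) * p z.2)
      ((volume.restrict (Ioc 0 b)).prod (volume.restrict (Ioc 0 b))) :=
    (by fun_prop : Continuous fun z : ℝ × ℝ => sinKernel μ (z.2 - z.1)).aestronglyMeasurable.mul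
      hp.aestronglyMeasurable.comp_snd
  exact h1.indicator (s := {z : ℝ × ℝ | z.1 < z.2}) (measurableSet_lt measurable_fst measurable_snd)

lemma abs_backwardKernel_le {μ b M : ℝ} (hM0 : 0 ≤ M) (hM : ∀ t ∈ Icc 0 b, |sinKernel μ t| ≤ M)
    {t s : ℝ} (ht : t ∈ Ioc 0 b) (hs : s ∈ Ioc 0 b) (y : ℝ) :
    |if t < s then sinKernel μ (s - t) * y else 0| ≤ M * |y| := by
  split_ifs with h
  · rw [abs_mul]
    gcongr
    exact hM _ ⟨by linarith, by linarith [ht.1, hs.2]⟩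
  · rw [abs_zero]
    positivity

lemma integrable_backwardKernel {μ b : ℝ} {p : ℝ → ℝ}
    (hp : Integrable p (volume.restrict (Ioc 0 b))) :
    Integrable (fun z : ℝ × ℝ => if z.1 < z.2 then sinKernel μ (z.2 - z.1) * p z.2 else 0)
      ((volume.restrict (Ioc 0 b)).prod (volume.restrict (Ioc 0 b))) := by
  obtain ⟨M, hM0, hM⟩ := exists_bound_sinKernel μ b
  refine Integrable.mono' (g := fun z : ℝ × ℝ => M * |p z.2|) ((hp.abs.comp_snd _).const_mul M)
    (aestronglyMeasurable_backwardKernel hp) ?_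
  rw [Measure.prod_restrict]
  refine (ae_restrict_iff' (measurableSet_Ioc.prod measurableSet_Ioc)).2
    (Eventually.of_forall fun z hz => ?_)
  exact abs_backwardKernel_le hM0 hM hz.1 hz.2 _

lemma memLp_backwardSolution {μ b : ℝ} {p : ℝ → ℝ}
    (hp : Integrable p (volume.restrict (Ioc 0 b))) :
    MemLp (backwardSolution μ b p) 2 (volume.restrict (Ioc 0 b)) := by
  obtain ⟨M, hM0, hM⟩ := exists_bound_sinKernel μ b
  refine MemLp.of_bound (aestronglyMeasurable_backwardKernel hp).integral_prod_right'.neg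
    (∫ s in Ioc 0 b, M * |p s|) ?_
  refine (ae_restrict_iff' measurableSet_Ioc).2 (Eventually.of_forall fun t ht => ?_)
  rw [backwardSolution, norm_neg]
  refine norm_integral_le_of_norm_le (hp.abs.const_mul M) ?_
  exact (ae_restrict_iff' measurableSet_Ioc).2 (Eventually.of_forall fun s hs =>
    abs_backwardKernel_le hM0 hM ht hs _)

/-- With `Φ(κ) = ∫ p · sinKernel κ`, the divided difference `(Φ(κ) - Φ(μ)) / (κ - μ)` is again a
transform of this kind. Fubini's theorem and the convolution identity replace integration by parts,
so `p` need only be square-integrable. -/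
lemma sub_mul_integral_backwardSolution {κ μ b : ℝ} {p : ℝ → ℝ}
    (hp : MemLp p 2 (volume.restrict (Ioc 0 b))) :
    (κ - μ) * ∫ t in Ioc 0 b, backwardSolution μ b p t * sinKernel κ t
      = (∫ t in Ioc 0 b, p t * sinKernel κ t) - ∫ t in Ioc 0 b, p t * sinKernel μ t := by
  have hp1 : Integrable p (volume.restrict (Ioc 0 b)) := hp.integrable one_le_two
  have hI : ∀ κ', Integrable (fun t => p t * sinKernel κ' t) (volume.restrict (Ioc 0 b)) :=
    fun κ' => integrable_mul_of_memLp hp (memLp_of_continuous (by fun_prop) _ _)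
  have e1 : ∫ t in Ioc 0 b, backwardSolution μ b p t * sinKernel κ t
      = -∫ t in Ioc 0 b, ∫ s in Ioc 0 b,
        (if t < s then sinKernel μ (s - t) * p s else 0) * sinKernel κ t := by
    rw [← integral_neg]
    refine integral_congr_ae (Eventually.of_forall fun t => ?_)
    simp only [backwardSolution]
    rw [integral_mul_const, neg_mul]
  have e2 : ∀ s ∈ Ioc 0 b, (κ - μ) * ∫ t in Ioc 0 b,
      (if t < s then sinKernel μ (s - t) * p s else 0) * sinKernel κ t
      = p s * sinKernel μ s - p s * sinKernel κ s := by
    intro s hs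
    have h1 : ∫ t in Ioc 0 b, (if t < s then sinKernel μ (s - t) * p s else 0) * sinKernel κ t
        = ∫ t in Ioc 0 s, p s * (sinKernel κ t * sinKernel μ (s - t)) := by
      have h2 : Ioo 0 s ⊆ Ioc 0 b := fun t ht => ⟨ht.1, ht.2.le.trans hs.2⟩
      rw [integral_Ioc_eq_integral_Ioo (x := (0 : ℝ)) (y := s),
        ← integral_indicator measurableSet_Ioo, ← integral_indicator measurableSet_Ioc]
      congr 1
      ext t
      by_cases ht : t ∈ Ioo 0 s
      · rw [indicator_of_mem ht, indicator_of_mem (h2 ht), if_pos ht.2]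
        ring
      · rw [indicator_of_notMem ht]
        by_cases ht' : t ∈ Ioc 0 b
        · rw [indicator_of_mem ht', if_neg fun h => ht ⟨ht'.1, h⟩, zero_mul]
        · rw [indicator_of_notMem ht']
    rw [h1, integral_const_mul, ← intervalIntegral.integral_of_le hs.1.le, mul_left_comm,
      sub_mul_integral_sinKernel_conv]
    ring
  have hsw := integral_integral_swap (μ := volume.restrict (Ioc 0 b))
    (ν := volume.restrict (Ioc 0 b))
    (f := fun t s => (if t < s then sinKernel μ (s - t) * p s else 0) * sinKernel κ t) (by
      obtain ⟨M, hM0, hM⟩ := exists_bound_sinKernel κ b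
      refine (integrable_backwardKernel hp1).mul_bdd (c := M)
        (by fun_prop : Continuous fun z : ℝ × ℝ => sinKernel κ z.1).aestronglyMeasurable ?_
      rw [Measure.prod_restrict]
      exact (ae_restrict_iff' (measurableSet_Ioc.prod measurableSet_Ioc)).2
        (Eventually.of_forall fun z hz => hM _ (Ioc_subset_Icc_self hz.1)))
  rw [e1, hsw, mul_neg, ← integral_const_mul, setIntegral_congr_fun measurableSet_Ioc e2,
    integral_sub (hI μ) (hI κ)]
  ring

lemma continuous_integral_mul_sinKernel {p : ℝ → ℝ} {b : ℝ}
    (hp : Integrable p (volume.restrict (Ioc 0 b))) :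
    Continuous fun κ => ∫ t in Ioc 0 b, p t * sinKernel κ t := by
  rw [continuous_iff_continuousAt]
  intro κ
  obtain ⟨M, hM⟩ := (isCompact_Icc.prod isCompact_Icc :
    IsCompact (Icc (κ - 1) (κ + 1) ×ˢ Icc 0 b)).exists_bound_of_continuousOn
      continuous_sinKernel.continuousOn
  refine continuousAt_of_dominated (bound := fun t => M * |p t|) ?_ ?_ (hp.abs.const_mul M) ?_
  · exact Eventually.of_forall fun κ' => hp.aestronglyMeasurable.mul
      (by fun_prop : Continuous fun t => sinKernel κ' t).aestronglyMeasurable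
  · filter_upwards [Icc_mem_nhds (by linarith : κ - 1 < κ) (by linarith : κ < κ + 1)] with κ' hκ'
    refine (ae_restrict_iff' measurableSet_Ioc).2 (Eventually.of_forall fun t ht => ?_)
    rw [norm_mul, mul_comm]
    exact mul_le_mul_of_nonneg_right (hM (κ', t) ⟨hκ', Ioc_subset_Icc_self ht⟩) (abs_nonneg _)
  · exact Eventually.of_forall fun t =>
      (by fun_prop : Continuous fun κ => p t * sinKernel κ t).continuousAt

/-- One member of a complete system can be exchanged. -/
lemma IsCompleteSystem.exchange {K : Set ℝ} {μ ν : ℝ} (hμ : μ ∉ K)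
    (h : IsCompleteSystem (insert ν K)) : IsCompleteSystem (insert μ K) := by
  intro p hp h0
  by_cases hμν : μ = ν
  · subst hμν
    exact h p hp h0
  have hpi := Real.pi_pos.le
  have hp1 : Integrable p (volume.restrict (Ioc 0 Real.pi)) := hp.integrable one_le_two
  simp only [intervalIntegral.integral_of_le hpi] at h0
  have hr : MemLp (backwardSolution μ Real.pi p) 2 (volume.restrict (Ioc 0 Real.pi)) :=
    memLp_backwardSolution hp1
  -- For `κ ≠ μ` the transform of `q` is `Φ(κ) (κ - ν) / (κ - μ)`: the zero of `Φ` at `μ` is traded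
  -- for one at `ν`.
  set q : ℝ → ℝ := fun t => p t + (μ - ν) * backwardSolution μ Real.pi p t with hq
  have hqm : MemLp q 2 (volume.restrict (Ioc 0 Real.pi)) := hp.add (hr.const_mul _)
  have hkey : ∀ κ, (κ - μ) * ∫ t in Ioc 0 Real.pi, q t * sinKernel κ t
      = (κ - ν) * ∫ t in Ioc 0 Real.pi, p t * sinKernel κ t := by
    intro κ
    have hs : MemLp (fun t => sinKernel κ t) 2 (volume.restrict (Ioc 0 Real.pi)) :=
      memLp_of_continuous (by fun_prop) _ _
    have h1 : ∫ t in Ioc 0 Real.pi, q t * sinKernel κ t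
        = (∫ t in Ioc 0 Real.pi, p t * sinKernel κ t)
        + (μ - ν) * ∫ t in Ioc 0 Real.pi, backwardSolution μ Real.pi p t * sinKernel κ t := by
      rw [← integral_const_mul, ← integral_add (integrable_mul_of_memLp hp hs)
        ((integrable_mul_of_memLp hr hs).const_mul _)]
      congr 1
      ext t
      rw [hq]
      ring
    have h2 := sub_mul_integral_backwardSolution (κ := κ) (μ := μ) hp
    rw [h0 μ (mem_insert _ _), sub_zero] at h2
    rw [h1]
    linear_combination (μ - ν) * h2
  have hq0 : q =ᵐ[volume.restrict (Ioc 0 Real.pi)] 0 := by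
    refine h q hqm fun κ hκ => ?_
    rw [intervalIntegral.integral_of_le hpi]
    have h1 := hkey κ
    rcases hκ with rfl | hκ
    · rw [sub_self, zero_mul] at h1
      exact (mul_eq_zero.1 h1).resolve_left (sub_ne_zero.2 (Ne.symm hμν))
    · rw [h0 κ (mem_insert_of_mem _ hκ), mul_zero] at h1
      exact (mul_eq_zero.1 h1).resolve_left (sub_ne_zero.2 fun h => hμ (h ▸ hκ))
  have hne : ∀ κ, κ ≠ ν → ∫ t in Ioc 0 Real.pi, p t * sinKernel κ t = 0 := by
    intro κ hκ
    have h1 := hkey κ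
    have h2 : ∫ t in Ioc 0 Real.pi, q t * sinKernel κ t = 0 := by
      refine integral_eq_zero_of_ae ?_
      filter_upwards [hq0] with t ht
      rw [ht]
      simp
    rw [h2, mul_zero] at h1
    exact (mul_eq_zero.1 h1.symm).resolve_left (sub_ne_zero.2 hκ)
  -- Dividing by `κ - ν` gives no information at `κ = ν`; continuity in `κ` fills this gap.
  have hall : (fun κ => ∫ t in Ioc 0 Real.pi, p t * sinKernel κ t) = fun _ => 0 :=
    Continuous.ext_on (s := {ν}ᶜ) (dense_compl_singleton ν) (continuous_integral_mul_sinKernel hp1)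
      continuous_const fun κ hκ => hne κ hκ
  refine ae_eq_zero_of_integral_mul_sin_half hp fun n => ?_
  refine integral_mul_sin_eq_zero (by positivity) ?_
  rw [intervalIntegral.integral_of_le hpi]
  exact congrFun hall _

/-- Induction on the size of `B \ A`. The hypothesis is applied to `A` with some `μ ∈ A \ B`
replaced by some `ν ∈ B \ A`, a set closer to `B`; a single exchange then restores `μ`. The bound on
cardinalities ensures that such a `μ` exists. -/
lemma IsCompleteSystem.exchange_finset_of_disjoint {K : Set ℝ} (A B : Finset ℝ)
    (hcard : B.card ≤ A.card) (hAK : ∀ x ∈ A, x ∉ K) (hBK : ∀ x ∈ B, x ∉ K)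
    (h : IsCompleteSystem (B ∪ K)) : IsCompleteSystem (A ∪ K) := by
  induction hn : (B \ A).card generalizing A with
  | zero =>
    have hBA : B ⊆ A := Finset.sdiff_eq_empty_iff_subset.1 (Finset.card_eq_zero.1 hn)
    exact h.mono (union_subset_union_left _ (by exact_mod_cast hBA))
  | succ k ih =>
    obtain ⟨ν, hν⟩ := Finset.card_pos.1 (by omega : 0 < (B \ A).card)
    have hAB : 0 < (A \ B).card := by
      have h1 := Finset.card_sdiff_add_card_inter A B
      have h2 := Finset.card_sdiff_add_card_inter B A
      rw [Finset.inter_comm] at h2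
      omega
    obtain ⟨μ, hμ⟩ := Finset.card_pos.1 hAB
    have hν' := Finset.mem_sdiff.1 hν
    have hμ' := Finset.mem_sdiff.1 hμ
    have hcard' : (insert ν (A.erase μ)).card = A.card := by
      rw [Finset.card_insert_of_notMem fun h => hν'.2 (Finset.mem_of_mem_erase h),
        Finset.card_erase_add_one hμ'.1]
    have hsd : B \ insert ν (A.erase μ) = (B \ A).erase ν := by
      ext x
      simp only [Finset.mem_sdiff, Finset.mem_insert, Finset.mem_erase]
      constructor
      · rintro ⟨hx, hx'⟩
        push Not at hx'
        refine ⟨hx'.1, hx, fun hxA => hx'.2 (fun hxμ => hμ'.2 (hxμ ▸ hx)) hxA⟩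
      · rintro ⟨hx1, hx2, hx3⟩
        refine ⟨hx2, fun h => h.elim hx1 fun h => hx3 h.2⟩
    have h1 : IsCompleteSystem (↑(insert ν (A.erase μ)) ∪ K) := by
      refine ih _ (by omega) (fun x hx => ?_) ?_
      · rcases Finset.mem_insert.1 hx with rfl | hx
        · exact hBK _ hν'.1
        · exact hAK _ (Finset.mem_of_mem_erase hx)
      · rw [hsd, Finset.card_erase_of_mem hν]
        omega
    rw [Finset.coe_insert, insert_union] at h1
    have h2 : IsCompleteSystem (insert μ (↑(A.erase μ) ∪ K)) := by
      refine IsCompleteSystem.exchange ?_ h1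
      rintro (h | h)
      · exact Finset.notMem_erase μ A (by exact_mod_cast h)
      · exact hAK _ hμ'.1 h
    rwa [← insert_union, ← Finset.coe_insert, Finset.insert_erase hμ'.1] at h2

lemma IsCompleteSystem.exchange_finset {K : Set ℝ} (A B : Finset ℝ)
    (hcard : B.card ≤ A.card) (hAK : ∀ x ∈ A, x ∉ K)
    (h : IsCompleteSystem (B ∪ K)) : IsCompleteSystem (A ∪ K) := by
  classical
  refine exchange_finset_of_disjoint A (B.filter (· ∉ K))
    ((Finset.card_filter_le _ _).trans hcard) hAK (fun x hx => (Finset.mem_filter.1 hx).2)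
    (h.mono ?_)
  rintro x (hx | hx)
  · by_cases hxK : x ∈ K
    · exact Or.inr hxK
    · exact Or.inl (by simpa [hxK] using hx)
  · exact Or.inr hx

/-- If `√μ_n = n + 1/2 + O(1/n)` and the `μ_n` are distinct, then the functions
`sin (√μ_n t) / √μ_n` are complete in `L²(0, π)`. -/
theorem isCompleteSystem_range {μ : ℕ → ℝ} (hinj : Function.Injective μ) {C : ℝ} {N₀ : ℕ}
    (hpos : ∀ n, N₀ ≤ n → 0 < μ n)
    (hasymp : ∀ n, N₀ ≤ n → |Real.sqrt (μ n) - (n + 1 / 2)| ≤ C / n) :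
    IsCompleteSystem (range μ) := by
  classical
  obtain ⟨N, hN, hc⟩ := exists_isCompleteSystem_tail
    (fun n hn => Real.sqrt_pos.2 (hpos n hn)) hasymp
  have hK : (fun n => Real.sqrt (μ n) ^ 2) '' Ici N = μ '' Ici N :=
    image_congr fun n hn => Real.sq_sqrt (hpos n (hN.trans hn)).le
  rw [hK] at hc
  have h := IsCompleteSystem.exchange_finset (K := μ '' Ici N) ((Finset.range N).image μ)
    ((Finset.range N).image fun n : ℕ => ((n : ℝ) + 1 / 2) ^ 2) ?_ ?_ (by simpa using hc)
  · refine h.mono ?_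
    rintro x (hx | ⟨n, -, rfl⟩)
    · obtain ⟨n, -, rfl⟩ := Finset.mem_image.1 (Finset.mem_coe.1 hx)
      exact mem_range_self _
    · exact mem_range_self _
  -- Distinctness of the `μ n` supplies exactly `N` members in place of at most `N` half-integer
  -- ones.
  · rw [Finset.card_image_of_injective _ hinj]
    exact Finset.card_image_le
  · intro x hx
    obtain ⟨n, hn, rfl⟩ := Finset.mem_image.1 hx
    rintro ⟨m, hm, hmn⟩
    have := hinj hmn
    have := Finset.mem_range.1 hn
    have : N ≤ m := hm
    omega

/-! ### Asymptotics of the terms of `H` -/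

lemma isBigO_one_div_freq {β : ℝ} (hβ : β ∈ Ioo 0 Real.pi) :
    (fun n => 1 / freq β n) =O[atTop] fun n : ℕ => 1 / (n : ℝ) := by
  refine IsBigO.of_bound 1 ?_
  filter_upwards [eventually_ge_atTop 1] with n hn
  have hn0 : (0 : ℝ) < n := by exact_mod_cast hn
  have hf := (freq_mem_Ioo hβ hn).1
  rw [Real.norm_of_nonneg (by have := hn0.trans hf; positivity),
    Real.norm_of_nonneg (by positivity), one_mul]
  gcongr

lemma isBigO_freq_sub {β : ℝ} (hβ : β ∈ Ioo 0 Real.pi) :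
    (fun n : ℕ => freq β n - (n + 1 / 2)) =O[atTop] fun n : ℕ => 1 / (n : ℝ) := by
  refine IsBigO.of_bound |Real.cos β / Real.sin β| ?_
  filter_upwards [eventually_ge_atTop 1] with n hn
  rw [Real.norm_eq_abs, Real.norm_of_nonneg (by positivity), mul_one_div]
  exact abs_freq_sub_le hβ hn

lemma tendsto_one_div_natCast : Tendsto (fun n : ℕ => 1 / (n : ℝ)) atTop (𝓝 0) :=
  tendsto_one_div_atTop_nhds_zero_nat

/-- The coefficients of the free problem: `1 / (a_n⁰ (λ_n⁰)²) = 2 / π + O(1/n²)`. -/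
lemma isBigO_freeNorming_inv_sub {β : ℝ} (hβ : β ∈ Ioo 0 Real.pi) :
    (fun n => 1 / (freeNorming β n * freq β n ^ 2) - 2 / Real.pi) =O[atTop]
      fun n : ℕ => (1 / (n : ℝ)) ^ 2 := by
  have h1 : (fun n => freeNorming β n * freq β n ^ 2 - Real.pi / 2) =O[atTop]
      fun n : ℕ => (1 / (n : ℝ)) ^ 2 := by
    refine IsBigO.of_bound |Real.cos β / Real.sin β| ?_
    filter_upwards [eventually_ge_atTop 1] with n hn
    rw [Real.norm_eq_abs, Real.norm_of_nonneg (by positivity), one_div, inv_pow,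
      ← div_eq_mul_inv]
    exact abs_freeNorming_sub_le hβ hn
  have hsq : Tendsto (fun n : ℕ => (1 / (n : ℝ)) ^ 2) atTop (𝓝 0) := by
    simpa using tendsto_one_div_natCast.pow 2
  have h2 : Tendsto (fun n => freeNorming β n * freq β n ^ 2) atTop (𝓝 (Real.pi / 2)) := by
    simpa using (h1.trans_tendsto hsq).add_const (Real.pi / 2)
  have hne : Real.pi / 2 ≠ 0 := by positivity
  have h3 : (fun n => (freeNorming β n * freq β n ^ 2)⁻¹) =O[atTop] fun _ : ℕ => (1 : ℝ) :=
    (h2.inv₀ hne).isBigO_one ℝ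
  have h4 := ((h1.mul h3).const_mul_left (-(2 / Real.pi)))
  simp only [mul_one] at h4
  refine h4.congr' ?_ EventuallyEq.rfl
  filter_upwards [h2.eventually_ne hne] with n hn
  have := Real.pi_ne_zero
  set X := freeNorming β n * freq β n ^ 2
  field_simp
  ring

/-- The coefficients of the perturbed problem, with `x = √μ_n`, `f = n + δ_n`, `a` the norming
constant: `1 / (a x²) = (2 / π) (1 - σ) + O(1/n²)`. -/
lemma isBigO_norming_inv_sub {f x a σ : ℕ → ℝ}
    (hf : (fun n => 1 / f n) =O[atTop] fun n : ℕ => 1 / (n : ℝ))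
    (hf0 : ∀ᶠ n in atTop, f n ≠ 0)
    (hσ : σ =O[atTop] fun n : ℕ => 1 / (n : ℝ))
    (hx : (fun n => x n - f n) =O[atTop] fun n : ℕ => 1 / (n : ℝ))
    (ha : ∀ᶠ n in atTop, a n = Real.pi / (2 * f n ^ 2) * (1 + σ n)) :
    (fun n => 1 / (a n * x n ^ 2) - 2 / Real.pi * (1 - σ n)) =O[atTop]
      fun n : ℕ => (1 / (n : ℝ)) ^ 2 := by
  have hsq : Tendsto (fun n : ℕ => (1 / (n : ℝ)) ^ 2) atTop (𝓝 0) := by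
    simpa using tendsto_one_div_natCast.pow 2
  have hσ0 : Tendsto σ atTop (𝓝 0) := hσ.trans_tendsto tendsto_one_div_natCast
  -- The relative error, `x = f (1 + u)`, gains a factor `1/n` over the absolute one.
  set u : ℕ → ℝ := fun n => (x n - f n) * (1 / f n) with hu
  have hu1 : u =O[atTop] fun n : ℕ => (1 / (n : ℝ)) ^ 2 := by
    simpa only [sq] using hx.mul hf
  have hu0 : Tendsto u atTop (𝓝 0) := hu1.trans_tendsto hsq
  have hd : Tendsto (fun n => (1 + σ n) * (1 + u n) ^ 2) atTop (𝓝 1) := by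
    simpa using (hσ0.const_add 1).mul ((hu0.const_add 1).pow 2)
  have hdi : (fun n => ((1 + σ n) * (1 + u n) ^ 2)⁻¹) =O[atTop] fun _ : ℕ => (1 : ℝ) :=
    (hd.inv₀ one_ne_zero).isBigO_one ℝ
  -- This is `1 - (1 - σ²)(1 + u)²`, the numerator of `1 / ((1 + σ)(1 + u)²) - (1 - σ)`.
  have hnum : (fun n => σ n ^ 2 - (1 - σ n ^ 2) * (2 + u n) * u n) =O[atTop]
      fun n : ℕ => (1 / (n : ℝ)) ^ 2 := by
    refine (hσ.pow 2).sub ?_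
    have hb : (fun n => (1 - σ n ^ 2) * (2 + u n)) =O[atTop] fun _ : ℕ => (1 : ℝ) :=
      (((hσ0.pow 2).const_sub 1).mul (hu0.const_add 2)).isBigO_one ℝ
    simpa using hb.mul hu1
  have h4 := (hnum.mul hdi).const_mul_left (2 / Real.pi)
  simp only [mul_one] at h4
  refine h4.congr' ?_ EventuallyEq.rfl
  filter_upwards [hd.eventually_ne one_ne_zero, hf0, ha] with n hn hfn han
  have hpi := Real.pi_ne_zero
  have hx' : x n = f n * (1 + u n) := by rw [hu]; field_simp; ring
  have h5 : a n * x n ^ 2 = Real.pi / 2 * ((1 + σ n) * (1 + u n) ^ 2) := by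
    rw [han, hx']; field_simp
  rw [h5]
  have h6 : (1 + σ n) ≠ 0 := left_ne_zero_of_mul hn
  have h7 : (1 + u n) ≠ 0 := by
    have := right_ne_zero_of_mul hn
    exact fun h => this (by rw [h]; simp)
  field_simp
  ring

lemma abs_cos_add_sub_le (x y : ℝ) :
    |Real.cos (x + y) - Real.cos x + y * Real.sin x| ≤ 3 * y ^ 2 := by
  have h1 : |Real.cos y - 1| ≤ y ^ 2 / 2 := by
    rw [abs_sub_comm, abs_of_nonneg (by linarith [Real.cos_le_one y])]
    linarith [Real.one_sub_sq_div_two_le_cos (x := y)]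
  have h2 : |y - Real.sin y| ≤ 2 * y ^ 2 := by
    rw [← sq_abs y]
    -- Taylor's formula serves for `|y| ≤ 1`; for `|y| ≥ 1` the trivial bound `|y| + 1 ≤ 2 y²`
    -- suffices.
    rcases le_total |y| 1 with hy | hy
    · have h4 : |y - Real.sin y| ≤ |y| ^ 3 / 6 + |y| ^ 5 / 100 := by
        have e : y - Real.sin y = y ^ 3 / 6 - (Real.sin y - (y - y ^ 3 / 6)) := by ring
        rw [e]
        refine (abs_sub _ _).trans ?_
        rw [abs_div, abs_pow, abs_of_pos (by norm_num : (0 : ℝ) < 6)]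
        gcongr
        exact Real.sin_bound hy
      have h5 : |y| ^ 3 ≤ |y| ^ 2 := pow_le_pow_of_le_one (abs_nonneg _) hy (by norm_num)
      have h6 : |y| ^ 5 ≤ |y| ^ 2 := pow_le_pow_of_le_one (abs_nonneg _) hy (by norm_num)
      nlinarith [sq_nonneg |y|]
    · have h3 := (abs_sub y (Real.sin y)).trans (add_le_add_right (Real.abs_sin_le_one y) _)
      nlinarith
  have e : Real.cos (x + y) - Real.cos x + y * Real.sin x
      = Real.cos x * (Real.cos y - 1) + (y - Real.sin y) * Real.sin x := by
    rw [Real.cos_add]; ring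
  rw [e]
  calc _ ≤ |Real.cos x * (Real.cos y - 1)| + |(y - Real.sin y) * Real.sin x| := abs_add_le _ _
    _ ≤ 1 * (y ^ 2 / 2) + 2 * y ^ 2 * 1 := by
        rw [abs_mul, abs_mul]
        gcongr
        · exact Real.abs_cos_le_one x
        · exact Real.abs_sin_le_one x
    _ ≤ _ := by nlinarith [sq_nonneg y]

/-- The `n`-th term of the series that defines `H`. -/
def termH (β : ℝ) (μ a : ℕ → ℝ) (n : ℕ) (t : ℝ) : ℝ :=
  1 / a n * cosKernel (μ n) t - 1 / freeNorming β n * cosKernel (freeEigenvalue β n) t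

/-- The asymptotic information about the data that enters the analysis of `H`, in real form:
`√μ_n = n + δ_n + ε_n` and `a_n = π / (2 (n + δ_n)²) (1 + σ_n)`. -/
structure IsPerturbation (β : ℝ) (μ a σ ε : ℕ → ℝ) : Prop where
  isBigO_norming : σ =O[atTop] fun n : ℕ => 1 / (n : ℝ)
  isBigO_freq : ε =O[atTop] fun n : ℕ => 1 / (n : ℝ)
  pos : ∀ᶠ n in atTop, 0 < μ n
  sqrt_eq : ∀ᶠ n in atTop, Real.sqrt (μ n) = freq β n + ε n
  norming_eq : ∀ᶠ n in atTop, a n = Real.pi / (2 * freq β n ^ 2) * (1 + σ n)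
  tendsto_cos : ∀ t ∈ Ioo 0 (2 * Real.pi), ∃ y,
    Tendsto (fun N => ∑ n ∈ Finset.range N, σ n * Real.cos (freq β n * t)) atTop (𝓝 y)
  tendsto_sin : ∀ t ∈ Ioo 0 (2 * Real.pi), ∃ y,
    Tendsto (fun N => ∑ n ∈ Finset.range N, ε n * Real.sin (freq β n * t)) atTop (𝓝 y)

lemma eventually_freq_pos {β : ℝ} (hβ : β ∈ Ioo 0 Real.pi) : ∀ᶠ n in atTop, 0 < freq β n := by
  filter_upwards [eventually_ge_atTop 1] with n hn
  exact lt_of_le_of_lt (Nat.cast_nonneg n) (freq_mem_Ioo hβ hn).1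

/-- The leading parts `(2/π) cos (f_n t)` of the two problems cancel. What remains beyond the linear
terms in `σ_n`, `ε_n` consists of `ε_n²`, `σ_n ε_n` and the errors of the coefficients. Uniformity
in `t` serves both pointwise and mean-square convergence. -/
lemma IsPerturbation.termH_bound {β : ℝ} (hβ : β ∈ Ioo 0 Real.pi) {μ a σ ε : ℕ → ℝ}
    (h : IsPerturbation β μ a σ ε) :
    ∃ b : ℕ → ℝ, b =O[atTop] (fun n : ℕ => (1 / (n : ℝ)) ^ 2) ∧
      ∀ᶠ n in atTop, ∀ t ∈ Icc 0 (2 * Real.pi),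
        |termH β μ a n t - 2 / Real.pi * (-(σ n * Real.cos (freq β n * t))
          - t * (ε n * Real.sin (freq β n * t)))| ≤ b n := by
  have hσ := h.isBigO_norming
  have hε := h.isBigO_freq
  have hσ0 : Tendsto σ atTop (𝓝 0) := hσ.trans_tendsto tendsto_one_div_natCast
  set x : ℕ → ℝ := fun n => Real.sqrt (μ n) with hx
  have hxf : (fun n => x n - freq β n) =O[atTop] fun n : ℕ => 1 / (n : ℝ) := by
    refine hε.congr' ?_ EventuallyEq.rfl
    filter_upwards [h.sqrt_eq] with n hn
    rw [hx]
    simp only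
    rw [hn]; ring
  set E₁ : ℕ → ℝ := fun n => 1 / (a n * x n ^ 2) - 2 / Real.pi * (1 - σ n) with hE₁
  set E₀ : ℕ → ℝ := fun n => 1 / (freeNorming β n * freq β n ^ 2) - 2 / Real.pi with hE₀
  have hE₁O : E₁ =O[atTop] fun n : ℕ => (1 / (n : ℝ)) ^ 2 :=
    isBigO_norming_inv_sub (isBigO_one_div_freq hβ)
      ((eventually_freq_pos hβ).mono fun n hn => hn.ne') hσ hxf h.norming_eq
  have hE₀O : E₀ =O[atTop] fun n : ℕ => (1 / (n : ℝ)) ^ 2 := isBigO_freeNorming_inv_sub hβ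
  refine ⟨fun n => |E₁ n| + 2 / Real.pi * (|1 - σ n| * (3 * (2 * Real.pi) ^ 2 * ε n ^ 2))
    + 2 / Real.pi * (2 * Real.pi * |σ n * ε n|) + |E₀ n|, ?_, ?_⟩
  · have hb : (fun n => |1 - σ n|) =O[atTop] fun _ : ℕ => (1 : ℝ) :=
      ((hσ0.const_sub 1).abs).isBigO_one ℝ
    refine ((hE₁O.abs_left.add (IsBigO.const_mul_left ?_ _)).add
      (IsBigO.const_mul_left (IsBigO.const_mul_left ?_ _) _)).add hE₀O.abs_left
    · simpa using hb.mul ((hε.pow 2).const_mul_left (3 * (2 * Real.pi) ^ 2))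
    · simpa only [sq] using (hσ.mul hε).abs_left
  · filter_upwards [h.pos, h.sqrt_eq, eventually_ge_atTop 1, eventually_freq_pos hβ]
      with n hμ hs hn hf t ht
    have hpi := Real.pi_pos
    have hx2 : x n ^ 2 = μ n := Real.sq_sqrt hμ.le
    have hcosarg : x n * t = freq β n * t + ε n * t := by rw [hx]; simp only; rw [hs]; ring
    set Q := Real.cos (freq β n * t + ε n * t) - Real.cos (freq β n * t)
      + ε n * t * Real.sin (freq β n * t) with hQ
    have hQb : |Q| ≤ 3 * (2 * Real.pi) ^ 2 * ε n ^ 2 := by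
      refine (abs_cos_add_sub_le _ _).trans ?_
      have : t ^ 2 ≤ (2 * Real.pi) ^ 2 := by gcongr; exacts [ht.1, ht.2]
      nlinarith [sq_nonneg (ε n)]
    have e : termH β μ a n t - 2 / Real.pi * (-(σ n * Real.cos (freq β n * t))
          - t * (ε n * Real.sin (freq β n * t)))
        = E₁ n * Real.cos (x n * t) + 2 / Real.pi * ((1 - σ n) * Q)
        + 2 / Real.pi * (t * (σ n * ε n) * Real.sin (freq β n * t))
        - E₀ n * Real.cos (freq β n * t) := by
      have e1 : termH β μ a n t = 1 / (a n * x n ^ 2) * Real.cos (x n * t)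
          - 1 / (freeNorming β n * freq β n ^ 2) * Real.cos (freq β n * t) := by
        rw [termH, cosKernel_of_pos hμ, cosKernel_of_pos (freeEigenvalue_pos hβ hn),
          ← freq_eq_sqrt, ← freq_sq hβ hn, show Real.sqrt (μ n) = x n from rfl, ← hx2]
        ring
      have e2 : 1 / (a n * x n ^ 2) = E₁ n + 2 / Real.pi * (1 - σ n) := by
        simp only [hE₁]; ring
      have e3 : 1 / (freeNorming β n * freq β n ^ 2) = E₀ n + 2 / Real.pi := by
        simp only [hE₀]; ring
      have e4 : Real.cos (x n * t) = Q + Real.cos (freq β n * t)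
          - ε n * t * Real.sin (freq β n * t) := by rw [hQ, hcosarg]; ring
      rw [e1, e2, e3, add_mul (E₁ n)]
      nth_rewrite 2 [e4]
      ring
    rw [e]
    have hc1 := Real.abs_cos_le_one (x n * t)
    have hc2 := Real.abs_cos_le_one (freq β n * t)
    have hs1 := Real.abs_sin_le_one (freq β n * t)
    refine (abs_sub _ _).trans (add_le_add ((abs_add_le _ _).trans (add_le_add
      ((abs_add_le _ _).trans (add_le_add ?_ ?_)) ?_)) ?_)
    · rw [abs_mul]
      exact mul_le_of_le_one_right (abs_nonneg _) hc1
    · rw [abs_mul, abs_mul, abs_of_pos (by positivity : 0 < 2 / Real.pi)]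
      gcongr
    · rw [abs_mul, abs_mul, abs_mul, abs_of_pos (by positivity : 0 < 2 / Real.pi),
        abs_of_nonneg ht.1]
      refine mul_le_mul_of_nonneg_left ?_ (by positivity)
      exact (mul_le_of_le_one_right (mul_nonneg ht.1 (abs_nonneg _)) hs1).trans
        (mul_le_mul_of_nonneg_right ht.2 (abs_nonneg _))
    · rw [abs_mul]
      exact mul_le_of_le_one_right (abs_nonneg _) hc2

/-! ### Pointwise convergence -/

lemma abs_sin_sub_sin_le (x y : ℝ) : |Real.sin x - Real.sin y| ≤ |x - y| := by
  simpa [Real.dist_eq] using Real.lipschitzWith_sin.dist_le_mul x y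

lemma abs_cos_sub_cos_le (x y : ℝ) : |Real.cos x - Real.cos y| ≤ |x - y| := by
  simpa [Real.dist_eq] using Real.lipschitzWith_cos.dist_le_mul x y

lemma sum_sin_half_mul (t : ℝ) (N : ℕ) :
    (∑ n ∈ Finset.range N, Real.sin ((n + 1 / 2) * t)) * (2 * Real.sin (t / 2))
      = 1 - Real.cos (N * t) := by
  induction N with
  | zero => simp
  | succ N ih =>
    rw [Finset.sum_range_succ, add_mul, ih]
    have h1 : ((N + 1 : ℕ) : ℝ) * t = (N + 1 / 2) * t + t / 2 := by push_cast; ring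
    have h2 : (N : ℝ) * t = (N + 1 / 2) * t - t / 2 := by ring
    rw [h1, Real.cos_add]
    nth_rewrite 1 [h2]
    rw [Real.cos_sub]
    ring

lemma exists_tendsto_of_isBigO {u : ℕ → ℝ}
    (h : u =O[atTop] fun n : ℕ => (1 / (n : ℝ)) ^ 2) :
    ∃ y, Tendsto (fun N => ∑ n ∈ Finset.range N, u n) atTop (𝓝 y) := by
  have hs : Summable fun n : ℕ => (1 / (n : ℝ)) ^ 2 := by
    simp
  exact ⟨_, (summable_of_isBigO_nat hs h).hasSum.tendsto_sum_nat⟩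

/-- The series `∑ sin (f_n t) / f_n` converges for `0 < t < 2π`. -/
lemma exists_tendsto_sum_sin_div_freq {β : ℝ} (hβ : β ∈ Ioo 0 Real.pi) {t : ℝ}
    (ht : t ∈ Ioo 0 (2 * Real.pi)) :
    ∃ y, Tendsto (fun N => ∑ n ∈ Finset.range N, 1 / freq β n * Real.sin (freq β n * t))
      atTop (𝓝 y) := by
  have hs : 0 < Real.sin (t / 2) :=
    Real.sin_pos_of_pos_of_lt_pi (by linarith [ht.1]) (by linarith [ht.2])
  -- Dirichlet's test is applied to the half-integer frequencies, whose sine sums are explicitly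
  -- bounded; passing to `freq β n` changes each term by `O(1/n²)`.
  have hanti : Antitone fun n : ℕ => 1 / ((n : ℝ) + 1 / 2) := by
    intro m n hmn
    have : (m : ℝ) ≤ n := by exact_mod_cast hmn
    simp only
    gcongr
  have hlim : Tendsto (fun n : ℕ => 1 / ((n : ℝ) + 1 / 2)) atTop (𝓝 0) :=
    tendsto_const_nhds.div_atTop
      (tendsto_atTop_add_const_right _ _ tendsto_natCast_atTop_atTop)
  have hbd : ∀ N, ‖∑ n ∈ Finset.range N, Real.sin (((n : ℕ) + 1 / 2) * t)‖
      ≤ 1 / Real.sin (t / 2) := by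
    intro N
    have h1 := sum_sin_half_mul t N
    rw [← eq_div_iff (by positivity)] at h1
    rw [h1, Real.norm_eq_abs, abs_of_nonneg (div_nonneg
      (by linarith [Real.cos_le_one (N * t)]) (by positivity)), div_le_div_iff₀ (by positivity) hs]
    nlinarith [Real.neg_one_le_cos (N * t)]
  obtain ⟨y₁, hy₁⟩ := cauchySeq_tendsto_of_complete
    (hanti.cauchySeq_series_mul_of_tendsto_zero_of_bounded hlim hbd)
  have hO1 := isBigO_one_div_freq hβ
  have hO2 := isBigO_freq_sub hβ
  have hO3 : (fun n : ℕ => 1 / ((n : ℝ) + 1 / 2)) =O[atTop] fun n : ℕ => 1 / (n : ℝ) := by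
    refine IsBigO.of_bound 1 ?_
    filter_upwards [eventually_ge_atTop 1] with n hn
    have hn0 : (0 : ℝ) < n := by exact_mod_cast hn
    rw [Real.norm_of_nonneg (by positivity), Real.norm_of_nonneg (by positivity), one_mul]
    gcongr
    linarith
  have hdiff : (fun n => 1 / freq β n * Real.sin (freq β n * t)
      - (1 / ((n : ℝ) + 1 / 2)) • Real.sin ((n + 1 / 2) * t)) =O[atTop]
      fun n : ℕ => (1 / (n : ℝ)) ^ 2 := by
    have h1 : (fun n => 1 / freq β n * (Real.sin (freq β n * t) - Real.sin ((n + 1 / 2) * t)))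
        =O[atTop] fun n : ℕ => (1 / (n : ℝ)) ^ 2 := by
      simp only [sq]
      refine hO1.mul ((IsBigO.of_bound |t| (Eventually.of_forall fun n => ?_)).trans hO2)
      rw [Real.norm_eq_abs, Real.norm_eq_abs, ← abs_mul]
      refine (abs_sin_sub_sin_le _ _).trans (le_of_eq ?_)
      congr 1
      ring
    have h2 : (fun n => (freq β n - (n + 1 / 2)) * (1 / freq β n * (1 / ((n : ℝ) + 1 / 2))))
        =O[atTop] fun n : ℕ => (1 / (n : ℝ)) ^ 2 := by
      have h3 : (fun n => (freq β n - (n + 1 / 2))) =O[atTop] fun _ : ℕ => (1 : ℝ) :=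
        (hO2.trans_tendsto tendsto_one_div_natCast).isBigO_one ℝ
      simpa [sq] using h3.mul (hO1.mul hO3)
    have h4 : (fun n : ℕ => Real.sin (((n : ℝ) + 1 / 2) * t)) =O[atTop] fun _ : ℕ => (1 : ℝ) :=
      IsBigO.of_bound 1 (Eventually.of_forall fun n => by
        simpa using Real.abs_sin_le_one _)
    have h24 := h2.mul h4
    simp only [mul_one] at h24
    refine ((h1.sub h24).congr' ?_ EventuallyEq.rfl)
    filter_upwards [eventually_freq_pos hβ] with n hn
    have : (n : ℝ) + 1 / 2 ≠ 0 := by positivity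
    rw [smul_eq_mul]
    set S := Real.sin (((n : ℝ) + 1 / 2) * t)
    have h6 : (freq β n - (n + 1 / 2)) * (1 / freq β n * (1 / ((n : ℝ) + 1 / 2)))
        = 1 / ((n : ℝ) + 1 / 2) - 1 / freq β n := by field_simp
    rw [h6]
    ring
  obtain ⟨y₂, hy₂⟩ := exists_tendsto_of_isBigO hdiff
  refine ⟨y₁ + y₂, (hy₁.add hy₂).congr fun N => ?_⟩
  rw [← Finset.sum_add_distrib]
  exact Finset.sum_congr rfl fun n _ => by ring

lemma exists_tendsto_range_of_Ico {x : ℕ → ℝ} {k : ℕ} {y : ℝ}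
    (h : Tendsto (fun N => ∑ n ∈ Finset.Ico k N, x n) atTop (𝓝 y)) :
    ∃ y, Tendsto (fun N => ∑ n ∈ Finset.range N, x n) atTop (𝓝 y) := by
  refine ⟨(∑ n ∈ Finset.range k, x n) + y, (h.const_add _).congr' ?_⟩
  filter_upwards [eventually_ge_atTop k] with N hN
  exact Finset.sum_range_add_sum_Ico _ hN

/-- Taking real parts, `σ_n = 2 s_n / (π f_n)` and `ε_n = c / (2 f_n) + Re l_n`. -/
lemma SpectralData.exists_isPerturbation {β : ℝ} (hβ : β ∈ Ioo 0 Real.pi) {μ a : ℕ → ℝ}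
    (h : SpectralData β μ a) : ∃ σ ε, IsPerturbation β μ a σ ε := by
  obtain ⟨-, -, c, l, s, hl, hs, hlo, hso, ⟨L, -, hL⟩, ⟨S, -, hS⟩⟩ := h
  have hf := isBigO_one_div_freq hβ
  have hlre : (fun n => (l n).re) =O[atTop] fun n : ℕ => 1 / (n : ℝ) :=
    (IsBigO.of_bound 1 (Eventually.of_forall fun n => by
      simpa using Complex.abs_re_le_norm (l n))).trans hlo.isBigO
  have hε : (fun n => c / 2 * (1 / freq β n) + (l n).re) =O[atTop] fun n : ℕ => 1 / (n : ℝ) :=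
    (hf.const_mul_left _).add hlre
  have hre : ∀ n, 2 ≤ n → Real.sqrt (μ n) = freq β n + (c / 2 * (1 / freq β n) + (l n).re) := by
    intro n hn
    have h1 := congrArg Complex.re (hl n hn)
    -- The real part of the complex root is `Real.sqrt (μ n)` for either sign of `μ n`, so no index
    -- has to be excluded here.
    rw [Complex.re_sqrt_ofReal] at h1
    rw [h1]
    have h2 : (freq β n : ℂ) + (c : ℂ) / (2 * (freq β n : ℂ))
        = ((freq β n + c / 2 * (1 / freq β n) : ℝ) : ℂ) := by
      push_cast
      ring
    rw [h2, Complex.add_re, Complex.ofReal_re, add_assoc]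
  refine ⟨fun n => 2 / Real.pi * (s n * (1 / freq β n)),
    fun n => c / 2 * (1 / freq β n) + (l n).re, ?_, hε, ?_, ?_, ?_, ?_, ?_⟩
  · refine IsBigO.const_mul_left ?_ _
    simpa using hso.isBigO.mul hf
  · have h0 := hε.trans_tendsto tendsto_one_div_natCast
    filter_upwards [eventually_ge_atTop 2, (tendsto_order.1 h0).1 (-1) (by norm_num)] with n hn hn1
    have h1 := hre n hn
    have h2 := (freq_mem_Ioo hβ (by omega : 1 ≤ n)).1
    have h3 : (2 : ℝ) ≤ n := by exact_mod_cast hn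
    exact Real.sqrt_pos.1 (by linarith)
  · filter_upwards [eventually_ge_atTop 2] with n hn using hre n hn
  · filter_upwards [eventually_ge_atTop 2] with n hn
    rw [hs n hn]
    congr 2
    ring
  · intro t ht
    have h1 := (hS t ht).const_mul (2 / Real.pi)
    simp_rw [Finset.mul_sum] at h1
    obtain ⟨y, hy⟩ := exists_tendsto_range_of_Ico h1
    refine ⟨y, hy.congr fun N => Finset.sum_congr rfl fun n _ => by ring⟩
  · intro t ht
    have h1 := (Complex.continuous_re.tendsto _).comp (hL t ht)
    simp only [Function.comp_def, Complex.re_sum, Complex.re_mul_ofReal] at h1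
    obtain ⟨y₁, hy₁⟩ := exists_tendsto_range_of_Ico h1
    obtain ⟨y₂, hy₂⟩ := exists_tendsto_sum_sin_div_freq hβ ht
    refine ⟨c / 2 * y₂ + y₁, ((hy₂.const_mul (c / 2)).add hy₁).congr fun N => ?_⟩
    rw [Finset.mul_sum, ← Finset.sum_add_distrib]
    exact Finset.sum_congr rfl fun n _ => by ring

lemma partialH_eq_sum (β : ℝ) (μ a : ℕ → ℝ) (N : ℕ) (t : ℝ) :
    partialH β μ a N t = ∑ n ∈ Finset.range N, termH β μ a n t := rfl

/-- The series that defines `H` converges on `(0, 2π)`. -/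
lemma IsPerturbation.tendsto_partialH {β : ℝ} (hβ : β ∈ Ioo 0 Real.pi) {μ a σ ε : ℕ → ℝ}
    (h : IsPerturbation β μ a σ ε) {t : ℝ} (ht : t ∈ Ioo 0 (2 * Real.pi)) :
    Tendsto (fun N => partialH β μ a N t) atTop (𝓝 (H β μ a t)) := by
  obtain ⟨b, hb, hbound⟩ := h.termH_bound hβ
  have hu : (fun n => termH β μ a n t - 2 / Real.pi * (-(σ n * Real.cos (freq β n * t))
      - t * (ε n * Real.sin (freq β n * t)))) =O[atTop] fun n : ℕ => (1 / (n : ℝ)) ^ 2 := by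
    refine (IsBigO.of_bound 1 ?_).trans hb
    filter_upwards [hbound] with n hn
    rw [one_mul, Real.norm_eq_abs]
    exact (hn t (Ioo_subset_Icc_self ht)).trans (le_abs_self _)
  obtain ⟨y₀, hy₀⟩ := exists_tendsto_of_isBigO hu
  obtain ⟨y₁, hy₁⟩ := h.tendsto_cos t ht
  obtain ⟨y₂, hy₂⟩ := h.tendsto_sin t ht
  have hlim : Tendsto (fun N => partialH β μ a N t) atTop
      (𝓝 (y₀ + 2 / Real.pi * (-y₁ - t * y₂))) := by
    refine (hy₀.add ((hy₁.neg.sub (hy₂.const_mul t)).const_mul (2 / Real.pi))).congr fun N => ?_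
    rw [partialH_eq_sum, Finset.mul_sum, ← Finset.sum_neg_distrib, ← Finset.sum_sub_distrib,
      Finset.mul_sum, ← Finset.sum_add_distrib]
    exact Finset.sum_congr rfl fun n _ => by ring
  exact tendsto_nhds_limUnder ⟨_, hlim⟩

/-! ### Mean-square convergence of the series for `H` -/

lemma integral_sq_sum_of_orthogonal {g : ℕ → ℝ → ℝ} {u v c : ℝ} (hg : ∀ n, Continuous (g n))
    (horth : ∀ m n, ∫ t in u..v, g m t * g n t = if m = n then c else 0) (α : ℕ → ℝ)
    (s : Finset ℕ) :
    ∫ t in u..v, (∑ n ∈ s, α n * g n t) ^ 2 = c * ∑ n ∈ s, α n ^ 2 := by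
  have e : ∀ t, (∑ n ∈ s, α n * g n t) ^ 2
      = ∑ m ∈ s, ∑ n ∈ s, α m * α n * (g m t * g n t) := fun t => by
    rw [sq, Finset.sum_mul_sum]
    exact Finset.sum_congr rfl fun m _ => Finset.sum_congr rfl fun n _ => by ring
  have hi : ∀ m n, IntervalIntegrable (fun t => α m * α n * (g m t * g n t)) volume u v :=
    fun m n => (((hg m).mul (hg n)).const_mul _).intervalIntegrable _ _
  simp_rw [e]
  rw [intervalIntegral.integral_finsetSum, Finset.mul_sum]
  · refine Finset.sum_congr rfl fun m hm => ?_
    rw [intervalIntegral.integral_finsetSum fun n _ => hi m n]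
    simp_rw [intervalIntegral.integral_const_mul, horth]
    simp only [mul_ite, mul_zero, Finset.sum_ite_eq, hm, if_true]
    ring
  · intro m _
    exact Continuous.intervalIntegrable (by fun_prop) _ _

lemma integral_cos_int_mul {k : ℤ} (hk : k ≠ 0) :
    ∫ t in (0 : ℝ)..(2 * Real.pi), Real.cos (k * t) = 0 := by
  rw [intervalIntegral.integral_comp_mul_left (fun y => Real.cos y) (by exact_mod_cast hk)]
  have : (k : ℝ) * (2 * Real.pi) = ((2 * k : ℤ) : ℝ) * Real.pi := by push_cast; ring
  rw [integral_cos, this, Real.sin_int_mul_pi]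
  simp

lemma integral_cos_half_mul_two_pi (m n : ℕ) :
    ∫ t in (0 : ℝ)..(2 * Real.pi), Real.cos ((m + 1 / 2) * t) * Real.cos ((n + 1 / 2) * t)
      = if m = n then Real.pi else 0 := by
  have e : ∀ t : ℝ, Real.cos ((m + 1 / 2) * t) * Real.cos ((n + 1 / 2) * t)
      = 1 / 2 * Real.cos (((m - n : ℤ) : ℝ) * t) + 1 / 2 * Real.cos (((m + n + 1 : ℤ) : ℝ) * t) := by
    intro t
    have h1 : ((m - n : ℤ) : ℝ) * t = (m + 1 / 2) * t - (n + 1 / 2) * t := by push_cast; ring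
    have h2 : ((m + n + 1 : ℤ) : ℝ) * t = (m + 1 / 2) * t + (n + 1 / 2) * t := by push_cast; ring
    rw [h1, h2, Real.cos_sub, Real.cos_add]
    ring
  simp_rw [e]
  rw [intervalIntegral.integral_add (Continuous.intervalIntegrable (by fun_prop) _ _)
    (Continuous.intervalIntegrable (by fun_prop) _ _), intervalIntegral.integral_const_mul,
    intervalIntegral.integral_const_mul, integral_cos_int_mul (k := m + n + 1) (by omega)]
  split_ifs with hmn
  · subst hmn
    simp
  · rw [integral_cos_int_mul (by omega)]
    simp

lemma integral_sin_half_mul_two_pi (m n : ℕ) :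
    ∫ t in (0 : ℝ)..(2 * Real.pi), Real.sin ((m + 1 / 2) * t) * Real.sin ((n + 1 / 2) * t)
      = if m = n then Real.pi else 0 := by
  have e : ∀ t : ℝ, Real.sin ((m + 1 / 2) * t) * Real.sin ((n + 1 / 2) * t)
      = 1 / 2 * Real.cos (((m - n : ℤ) : ℝ) * t) - 1 / 2 * Real.cos (((m + n + 1 : ℤ) : ℝ) * t) := by
    intro t
    have h1 : ((m - n : ℤ) : ℝ) * t = (m + 1 / 2) * t - (n + 1 / 2) * t := by push_cast; ring
    have h2 : ((m + n + 1 : ℤ) : ℝ) * t = (m + 1 / 2) * t + (n + 1 / 2) * t := by push_cast; ring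
    rw [h1, h2, Real.cos_sub, Real.cos_add]
    ring
  simp_rw [e]
  rw [intervalIntegral.integral_sub (Continuous.intervalIntegrable (by fun_prop) _ _)
    (Continuous.intervalIntegrable (by fun_prop) _ _), intervalIntegral.integral_const_mul,
    intervalIntegral.integral_const_mul, integral_cos_int_mul (k := m + n + 1) (by omega)]
  split_ifs with hmn
  · subst hmn
    simp
  · rw [integral_cos_int_mul (by omega)]
    simp

@[fun_prop]
lemma continuous_termH (β : ℝ) (μ a : ℕ → ℝ) (n : ℕ) : Continuous fun t => termH β μ a n t := by
  unfold termH
  fun_prop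

@[fun_prop]
lemma continuous_partialH (β : ℝ) (μ a : ℕ → ℝ) (N : ℕ) :
    Continuous fun t => partialH β μ a N t := by
  simp_rw [partialH_eq_sum]
  fun_prop

/-- Comparison of the terms of `H` with an orthogonal system. -/
lemma IsPerturbation.termH_bound_half {β : ℝ} (hβ : β ∈ Ioo 0 Real.pi) {μ a σ ε : ℕ → ℝ}
    (h : IsPerturbation β μ a σ ε) :
    ∃ A B b : ℕ → ℝ, (Summable fun n => A n ^ 2) ∧ (Summable fun n => B n ^ 2) ∧
      Summable b ∧ ∀ᶠ n in atTop, ∀ t ∈ Icc 0 (2 * Real.pi),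
        |termH β μ a n t - A n * Real.cos ((n + 1 / 2) * t)
          - t * (B n * Real.sin ((n + 1 / 2) * t))| ≤ b n := by
  obtain ⟨b, hb, hbound⟩ := h.termH_bound hβ
  have hpi := Real.pi_pos
  have hσ := h.isBigO_norming
  have hε := h.isBigO_freq
  have hs : Summable fun n : ℕ => (1 / (n : ℝ)) ^ 2 := by
    simp
  have hd := (isBigO_freq_sub hβ).abs_left
  refine ⟨fun n => -(2 / Real.pi) * σ n, fun n => -(2 / Real.pi) * ε n,
    fun n => b n + (2 / Real.pi * (2 * Real.pi)) * (|σ n| * |freq β n - (n + 1 / 2)|)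
      + (2 / Real.pi * (2 * Real.pi) ^ 2) * (|ε n| * |freq β n - (n + 1 / 2)|),
    summable_of_isBigO_nat hs ((hσ.const_mul_left _).pow 2),
    summable_of_isBigO_nat hs ((hε.const_mul_left _).pow 2),
    summable_of_isBigO_nat hs ((hb.add (IsBigO.const_mul_left ?_ _)).add
      (IsBigO.const_mul_left ?_ _)), ?_⟩
  · simpa only [sq] using hσ.abs_left.mul hd
  · simpa only [sq] using hε.abs_left.mul hd
  · filter_upwards [hbound] with n hn t ht
    set D := |freq β n - (n + 1 / 2)| with hD
    have harg : |freq β n * t - (n + 1 / 2) * t| ≤ D * (2 * Real.pi) := by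
      rw [← sub_mul, abs_mul, abs_of_nonneg ht.1]
      gcongr
      exact ht.2
    have hc := (abs_cos_sub_cos_le _ _).trans harg
    have hsn := (abs_sin_sub_sin_le _ _).trans harg
    have e : termH β μ a n t - -(2 / Real.pi) * σ n * Real.cos ((n + 1 / 2) * t)
          - t * (-(2 / Real.pi) * ε n * Real.sin ((n + 1 / 2) * t))
        = (termH β μ a n t - 2 / Real.pi * (-(σ n * Real.cos (freq β n * t))
          - t * (ε n * Real.sin (freq β n * t))))
        - 2 / Real.pi * (σ n * (Real.cos (freq β n * t) - Real.cos ((n + 1 / 2) * t)))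
        - 2 / Real.pi * (t * (ε n * (Real.sin (freq β n * t) - Real.sin ((n + 1 / 2) * t)))) := by
      ring
    rw [e]
    refine (abs_sub _ _).trans (add_le_add ((abs_sub _ _).trans (add_le_add (hn t ht) ?_)) ?_)
    · rw [abs_mul, abs_mul, abs_of_pos (by positivity : 0 < 2 / Real.pi)]
      calc _ ≤ 2 / Real.pi * (|σ n| * (D * (2 * Real.pi))) := by gcongr
        _ = _ := by ring
    · rw [abs_mul, abs_mul, abs_mul, abs_of_pos (by positivity : 0 < 2 / Real.pi),
        abs_of_nonneg ht.1]
      calc _ ≤ 2 / Real.pi * ((2 * Real.pi) * (|ε n| * (D * (2 * Real.pi)))) := by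
            gcongr
            exact ht.2
        _ = _ := by ring

lemma sum_Ico_le_tsum_nat_add {u : ℕ → ℝ} (hu : Summable u) (h0 : ∀ n, 0 ≤ u n) (M N : ℕ) :
    ∑ n ∈ Finset.Ico M N, u n ≤ ∑' k, u (k + M) := by
  rw [Finset.sum_Ico_eq_sum_range]
  simp_rw [add_comm M]
  exact ((summable_nat_add_iff M).2 hu).sum_le_tsum _ fun _ _ => h0 _

/-- The block of terms splits as `U + t V + W`: an orthogonal cosine sum, an orthogonal sine sum and
a uniformly small remainder. The weight is bounded by `t ≤ 2π` before orthogonality is used, and `(x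
+ y + z)² ≤ 3 (x² + y² + z²)` gives the factor `3`. -/
lemma IsPerturbation.integral_sq_partialH_sub_le {β : ℝ} (hβ : β ∈ Ioo 0 Real.pi)
    {μ a σ ε : ℕ → ℝ} (h : IsPerturbation β μ a σ ε) :
    ∃ δ : ℕ → ℝ, Tendsto δ atTop (𝓝 0) ∧ ∀ᶠ M in atTop, ∀ N, M ≤ N →
      ∫ t in (0 : ℝ)..(2 * Real.pi), (partialH β μ a M t - partialH β μ a N t) ^ 2 ≤ δ M := by
  obtain ⟨A, B, b, hA, hB, hb, hbound⟩ := h.termH_bound_half hβ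
  have hpi := Real.pi_pos
  have hb' : Summable fun n => |b n| := hb.abs
  refine ⟨fun M => 3 * (Real.pi * ∑' k, A (k + M) ^ 2
    + (2 * Real.pi) ^ 2 * (Real.pi * ∑' k, B (k + M) ^ 2)
    + 2 * Real.pi * (∑' k, |b (k + M)|) ^ 2), ?_, ?_⟩
  · have h1 := tendsto_sum_nat_add fun n => A n ^ 2
    have h2 := tendsto_sum_nat_add fun n => B n ^ 2
    have h3 := tendsto_sum_nat_add fun n => |b n|
    simpa using ((((h1.const_mul Real.pi).add ((h2.const_mul Real.pi).const_mul
      ((2 * Real.pi) ^ 2))).add ((h3.pow 2).const_mul (2 * Real.pi))).const_mul 3)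
  · obtain ⟨M₀, hM₀⟩ := eventually_atTop.1 hbound
    filter_upwards [eventually_ge_atTop M₀] with M hM N hMN
    set s := Finset.Ico M N
    set U : ℝ → ℝ := fun t => ∑ n ∈ s, A n * Real.cos ((n + 1 / 2) * t) with hU
    set V : ℝ → ℝ := fun t => ∑ n ∈ s, B n * Real.sin ((n + 1 / 2) * t) with hV
    set W : ℝ → ℝ := fun t => ∑ n ∈ s, (termH β μ a n t - A n * Real.cos ((n + 1 / 2) * t)
          - t * (B n * Real.sin ((n + 1 / 2) * t))) with hW
    have hUc : Continuous U := by fun_prop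
    have hVc : Continuous V := by fun_prop
    have hWc : Continuous W := by fun_prop
    have e : ∀ t, partialH β μ a M t - partialH β μ a N t = -(U t + t * V t + W t) := by
      intro t
      rw [partialH_eq_sum, partialH_eq_sum, ← Finset.sum_range_add_sum_Ico _ hMN, hU, hV, hW]
      simp only
      rw [Finset.mul_sum, ← Finset.sum_add_distrib, ← Finset.sum_add_distrib, sub_add_cancel_left]
      congr 1
      exact Finset.sum_congr rfl fun n _ => by ring
    have hWb : ∀ t ∈ Icc 0 (2 * Real.pi), |W t| ≤ ∑' k, |b (k + M)| := by
      intro t ht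
      refine (Finset.abs_sum_le_sum_abs _ _).trans ?_
      refine le_trans (Finset.sum_le_sum fun n hn => ?_)
        (sum_Ico_le_tsum_nat_add hb' (fun _ => abs_nonneg _) M N)
      exact (hM₀ n (hM.trans (Finset.mem_Ico.1 hn).1) t ht).trans (le_abs_self _)
    have hle : ∀ t ∈ Icc 0 (2 * Real.pi), (partialH β μ a M t - partialH β μ a N t) ^ 2
        ≤ 3 * (U t ^ 2 + (2 * Real.pi) ^ 2 * V t ^ 2 + (∑' k, |b (k + M)|) ^ 2) := by
      intro t ht
      rw [e, neg_sq]
      have h1 : W t ^ 2 ≤ (∑' k, |b (k + M)|) ^ 2 := by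
        rw [← sq_abs]
        gcongr
        exact hWb t ht
      have h2 : (t * V t) ^ 2 ≤ (2 * Real.pi) ^ 2 * V t ^ 2 := by
        rw [mul_pow]
        gcongr
        exacts [ht.1, ht.2]
      nlinarith [sq_nonneg (U t - t * V t), sq_nonneg (U t - W t), sq_nonneg (t * V t - W t)]
    calc _ ≤ ∫ t in (0 : ℝ)..(2 * Real.pi),
          3 * (U t ^ 2 + (2 * Real.pi) ^ 2 * V t ^ 2 + (∑' k, |b (k + M)|) ^ 2) :=
          intervalIntegral.integral_mono_on (by positivity)
            (Continuous.intervalIntegrable (by fun_prop) _ _)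
            (Continuous.intervalIntegrable (by fun_prop) _ _) hle
      _ = 3 * (Real.pi * ∑ n ∈ s, A n ^ 2 + (2 * Real.pi) ^ 2 * (Real.pi * ∑ n ∈ s, B n ^ 2)
          + 2 * Real.pi * (∑' k, |b (k + M)|) ^ 2) := by
          rw [intervalIntegral.integral_const_mul, intervalIntegral.integral_add
            (Continuous.intervalIntegrable (by fun_prop) _ _)
            (Continuous.intervalIntegrable (by fun_prop) _ _), intervalIntegral.integral_add
            (Continuous.intervalIntegrable (by fun_prop) _ _)
            (Continuous.intervalIntegrable (by fun_prop) _ _),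
            intervalIntegral.integral_const_mul, intervalIntegral.integral_const, hU, hV,
            integral_sq_sum_of_orthogonal (fun n => by fun_prop) integral_cos_half_mul_two_pi,
            integral_sq_sum_of_orthogonal (fun n => by fun_prop) integral_sin_half_mul_two_pi]
          simp
      _ ≤ _ := by
          gcongr
          · exact sum_Ico_le_tsum_nat_add hA (fun _ => sq_nonneg _) M N
          · exact sum_Ico_le_tsum_nat_add hB (fun _ => sq_nonneg _) M N

lemma eLpNorm_two_eq {α : Type*} [MeasurableSpace α] {ν : Measure α} {f : α → ℝ}
    (hf : MemLp f 2 ν) : eLpNorm f 2 ν = ENNReal.ofReal (Real.sqrt (∫ x, f x ^ 2 ∂ν)) := by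
  have h1 : ‖hf.toLp f‖ ^ 2 = ∫ x, f x ^ 2 ∂ν := by
    rw [← real_inner_self_eq_norm_sq, inner_toLp]
    simp_rw [sq]
  rw [← h1, Real.sqrt_sq (norm_nonneg _), Lp.norm_toLp, ENNReal.ofReal_toReal hf.eLpNorm_ne_top]

lemma IsPerturbation.ae_tendsto_partialH {β : ℝ} (hβ : β ∈ Ioo 0 Real.pi) {μ a σ ε : ℕ → ℝ}
    (h : IsPerturbation β μ a σ ε) :
    ∀ᵐ t ∂(volume.restrict (Ioc 0 (2 * Real.pi))),
      Tendsto (fun N => partialH β μ a N t) atTop (𝓝 (H β μ a t)) := by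
  rw [← restrict_Ioo_eq_restrict_Ioc]
  exact (ae_restrict_iff' measurableSet_Ioo).2 (Eventually.of_forall fun t ht =>
    h.tendsto_partialH hβ ht)

/-- Fatou's lemma carries the Cauchy estimate to the pointwise limit `H`. -/
lemma IsPerturbation.tendsto_eLpNorm_partialH_sub {β : ℝ} (hβ : β ∈ Ioo 0 Real.pi)
    {μ a σ ε : ℕ → ℝ} (h : IsPerturbation β μ a σ ε) :
    Tendsto (fun M => eLpNorm (fun t => partialH β μ a M t - H β μ a t) 2
      (volume.restrict (Ioc 0 (2 * Real.pi)))) atTop (𝓝 0) := by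
  obtain ⟨δ, hδ, hδb⟩ := h.integral_sq_partialH_sub_le hβ
  have hlim : Tendsto (fun M => ENNReal.ofReal (Real.sqrt (δ M))) atTop (𝓝 0) := by
    have := ENNReal.tendsto_ofReal ((Real.continuous_sqrt.tendsto 0).comp hδ)
    simpa using this
  refine tendsto_of_tendsto_of_tendsto_of_le_of_le' tendsto_const_nhds hlim
    (Eventually.of_forall fun _ => zero_le) ?_
  filter_upwards [hδb] with M hM
  have hcont : ∀ N, MemLp (fun t => partialH β μ a M t - partialH β μ a N t) 2
      (volume.restrict (Ioc 0 (2 * Real.pi))) := fun N => memLp_of_continuous (by fun_prop) _ _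
  refine (Lp.eLpNorm_lim_le_liminf_eLpNorm (fun N => (hcont N).1) _ ?_).trans ?_
  · filter_upwards [h.ae_tendsto_partialH hβ] with t ht
    exact ht.const_sub _
  · refine liminf_le_of_frequently_le' (Eventually.frequently ?_)
    filter_upwards [eventually_ge_atTop M] with N hN
    rw [eLpNorm_two_eq (hcont N)]
    refine ENNReal.ofReal_le_ofReal (Real.sqrt_le_sqrt ?_)
    rw [← intervalIntegral.integral_of_le (by have := Real.pi_pos; positivity)]
    exact hM N hN

lemma IsPerturbation.memLp_H {β : ℝ} (hβ : β ∈ Ioo 0 Real.pi) {μ a σ ε : ℕ → ℝ}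
    (h : IsPerturbation β μ a σ ε) :
    MemLp (H β μ a) 2 (volume.restrict (Ioc 0 (2 * Real.pi))) := by
  have hmeas : AEStronglyMeasurable (H β μ a) (volume.restrict (Ioc 0 (2 * Real.pi))) :=
    aestronglyMeasurable_of_tendsto_ae atTop
      (fun N => (continuous_partialH β μ a N).aestronglyMeasurable) (h.ae_tendsto_partialH hβ)
  obtain ⟨M, hM⟩ := ((h.tendsto_eLpNorm_partialH_sub hβ).eventually
    (gt_mem_nhds ENNReal.zero_lt_top)).exists
  have h1 : MemLp (fun t => partialH β μ a M t) 2 (volume.restrict (Ioc 0 (2 * Real.pi))) :=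
    memLp_of_continuous (by fun_prop) _ _
  have h2 : MemLp (fun t => partialH β μ a M t - H β μ a t) 2
      (volume.restrict (Ioc 0 (2 * Real.pi))) := ⟨h1.1.sub hmeas, hM⟩
  have h3 := h1.sub h2
  refine h3.congr_norm hmeas (Eventually.of_forall fun t => ?_)
  simp

/-- The functions `sin (√μ_n t) / √μ_n` are complete in `L²(0, π)`. -/
lemma IsPerturbation.isCompleteSystem {β : ℝ} (hβ : β ∈ Ioo 0 Real.pi) {μ a σ ε : ℕ → ℝ}
    (h : IsPerturbation β μ a σ ε) (hinj : Function.Injective μ) :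
    IsCompleteSystem (range μ) := by
  have hO : (fun n : ℕ => Real.sqrt (μ n) - (n + 1 / 2)) =O[atTop] fun n : ℕ => 1 / (n : ℝ) := by
    refine ((isBigO_freq_sub hβ).add h.isBigO_freq).congr' ?_ EventuallyEq.rfl
    filter_upwards [h.sqrt_eq] with n hn
    rw [hn]
    ring
  obtain ⟨C, hC⟩ := hO.bound
  obtain ⟨N₀, hN₀⟩ := eventually_atTop.1 (hC.and h.pos)
  refine isCompleteSystem_range hinj (C := C) (N₀ := N₀) (fun n hn => (hN₀ n hn).2) fun n hn => ?_
  have := (hN₀ n hn).1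
  rwa [Real.norm_eq_abs, Real.norm_of_nonneg (by positivity), mul_one_div] at this

/-! ### The Gelfand–Levitan operator -/

/-- The kernel `(h(|s - t|) - h(s + t)) / 2`. -/
def diffKernel (h : ℝ → ℝ) (t s : ℝ) : ℝ := 1 / 2 * (h |s - t| - h (s + t))

/-- Translation preserves volume; the factor `2` only matches the bound for `s ↦ |s - t|`. -/
lemma map_add_right_restrict_le {x t c : ℝ} (ht : 0 ≤ t) (hc : x + t ≤ c) :
    (volume.restrict (Ioc 0 x)).map (fun s => s + t) ≤ (2 : ENNReal) • volume.restrict (Ioc 0 c) := by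
  refine Measure.le_iff.2 fun A hA => ?_
  rw [Measure.map_apply (by fun_prop) hA, Measure.restrict_apply (measurable_add_const t hA),
    Measure.smul_apply, Measure.restrict_apply hA, smul_eq_mul]
  calc volume ((fun s => s + t) ⁻¹' A ∩ Ioc 0 x)
      ≤ volume ((fun s => s + t) ⁻¹' (A ∩ Ioc 0 c)) := by
        refine measure_mono fun s hs => ⟨hs.1, ?_, ?_⟩
        · simp only; linarith [hs.2.1]
        · simp only; linarith [hs.2.2]
    _ = 1 * volume (A ∩ Ioc 0 c) := by rw [measure_preimage_add_right, one_mul]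
    _ ≤ _ := by gcongr; norm_num

lemma map_abs_sub_restrict_le {x t c : ℝ} (ht : t ∈ Icc 0 x) (hc : x ≤ c) :
    (volume.restrict (Ioc 0 x)).map (fun s => |s - t|) ≤
      (2 : ENNReal) • volume.restrict (Ioc 0 c) := by
  refine Measure.le_iff.2 fun A hA => ?_
  have hm : Measurable fun s : ℝ => |s - t| := by fun_prop
  rw [Measure.map_apply hm hA, Measure.restrict_apply (hm hA),
    Measure.smul_apply, Measure.restrict_apply hA, smul_eq_mul]
  calc volume ((fun s => |s - t|) ⁻¹' A ∩ Ioc 0 x)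
      -- The folding map has two measure-preserving branches, whence the factor `2`; its value `0`
      -- at `s = t` lies outside `Ioc 0 c` and costs a null set.
      ≤ volume (((fun s => s - t) ⁻¹' (A ∩ Ioc 0 c) ∪ (fun s => t - s) ⁻¹' (A ∩ Ioc 0 c)) ∪ {t}) := by
        refine measure_mono fun s hs => ?_
        rcases lt_trichotomy s t with h | h | h
        · refine Or.inl (Or.inr ⟨?_, ?_, ?_⟩)
          · have := hs.1
            rwa [mem_preimage, abs_of_neg (by linarith), neg_sub] at this
          · simp only; linarith
          · simp only; linarith [hs.2.1, ht.2]
        · exact Or.inr h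
        · refine Or.inl (Or.inl ⟨?_, ?_, ?_⟩)
          · have := hs.1
            rwa [mem_preimage, abs_of_pos (by linarith)] at this
          · simp only; linarith
          · simp only; linarith [hs.2.2, ht.1]
    _ ≤ (volume (A ∩ Ioc 0 c) + volume (A ∩ Ioc 0 c)) + 0 := by
        refine (measure_union_le _ _).trans (add_le_add ((measure_union_le _ _).trans
          (add_le_add (le_of_eq ?_) (le_of_eq ?_))) (le_of_eq ?_))
        · simp_rw [sub_eq_add_neg]
          exact measure_preimage_add_right _ _ _
        · exact (Measure.measurePreserving_sub_left volume t).measure_preimage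
            (hA.inter measurableSet_Ioc).nullMeasurableSet
        · exact measure_singleton t
    _ = _ := by rw [add_zero, two_mul]

lemma memLp_comp_of_map_le {ν ν' : Measure ℝ} {T : ℝ → ℝ} (hT : Measurable T)
    (hle : ν.map T ≤ (2 : ENNReal) • ν') {h : ℝ → ℝ} (hh : MemLp h 2 ν') :
    MemLp (fun s => h (T s)) 2 ν ∧ ∫ s, h (T s) ^ 2 ∂ν ≤ 2 * ∫ s, h s ^ 2 ∂ν' := by
  have h1 : MemLp h 2 (ν.map T) := hh.of_measure_le_smul (by norm_num) hle
  refine ⟨h1.comp_of_map hT.aemeasurable, ?_⟩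
  rw [← integral_map (f := fun y => h y ^ 2) hT.aemeasurable (h1.1.pow 2)]
  calc _ ≤ ∫ y, h y ^ 2 ∂((2 : ENNReal) • ν') :=
        integral_mono_measure hle (Eventually.of_forall fun _ => sq_nonneg _)
          (hh.integrable_sq.smul_measure (by norm_num))
    _ = _ := by rw [integral_smul_measure]; simp

/-- The bound holds for every `t`, uniformly, although `h` is only square-integrable; `x ≤ π` keeps
`s + t` inside `[0, 2π]`. -/
lemma memLp_diffKernel {x t : ℝ} (hx : x ≤ Real.pi) (ht : t ∈ Icc 0 x) {h : ℝ → ℝ}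
    (hh : MemLp h 2 (volume.restrict (Ioc 0 (2 * Real.pi)))) :
    MemLp (diffKernel h t) 2 (volume.restrict (Ioc 0 x)) ∧
      ∫ s in Ioc 0 x, diffKernel h t s ^ 2 ≤ 2 * ∫ s in Ioc 0 (2 * Real.pi), h s ^ 2 := by
  have hpi := Real.pi_pos
  obtain ⟨h1, h1'⟩ := memLp_comp_of_map_le (by fun_prop)
    (map_abs_sub_restrict_le (c := 2 * Real.pi) ht (by linarith)) hh
  obtain ⟨h2, h2'⟩ := memLp_comp_of_map_le (by fun_prop)
    (map_add_right_restrict_le (x := x) (c := 2 * Real.pi) ht.1 (by linarith [ht.2])) hh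
  refine ⟨(h1.sub h2).const_mul _, ?_⟩
  have hle : ∀ s, diffKernel h t s ^ 2 ≤ 1 / 2 * h |s - t| ^ 2 + 1 / 2 * h (s + t) ^ 2 := by
    intro s
    rw [diffKernel]
    nlinarith [sq_nonneg (h |s - t| + h (s + t))]
  have hm : MemLp (diffKernel h t) 2 (volume.restrict (Ioc 0 x)) := (h1.sub h2).const_mul _
  calc _ ≤ ∫ s in Ioc 0 x, (1 / 2 * h |s - t| ^ 2 + 1 / 2 * h (s + t) ^ 2) :=
        integral_mono hm.integrable_sq
          ((h1.integrable_sq.const_mul _).add (h2.integrable_sq.const_mul _)) hle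
    _ = 1 / 2 * (∫ s in Ioc 0 x, h |s - t| ^ 2) + 1 / 2 * ∫ s in Ioc 0 x, h (s + t) ^ 2 := by
        rw [integral_add (h1.integrable_sq.const_mul _) (h2.integrable_sq.const_mul _),
          integral_const_mul, integral_const_mul]
    _ ≤ _ := by linarith

lemma norm_sq_eq_integral {ν : Measure ℝ} (p : Lp ℝ 2 ν) : ‖p‖ ^ 2 = ∫ s, p s ^ 2 ∂ν := by
  conv_lhs => rw [← Lp.toLp_coeFn p (Lp.memLp p), ← real_inner_self_eq_norm_sq, inner_toLp]
  simp_rw [sq]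

lemma abs_integral_mul_diffKernel_le {x t : ℝ} (hx : x ≤ Real.pi) (ht : t ∈ Icc 0 x) {h : ℝ → ℝ}
    (hh : MemLp h 2 (volume.restrict (Ioc 0 (2 * Real.pi))))
    (p : Lp ℝ 2 (volume.restrict (Ioc 0 x))) :
    |∫ s in Ioc 0 x, p s * diffKernel h t s| ≤
      ‖p‖ * Real.sqrt (2 * ∫ s in Ioc 0 (2 * Real.pi), h s ^ 2) := by
  obtain ⟨h1, h2⟩ := memLp_diffKernel hx ht hh
  refine abs_le_of_sq_le_sq ?_ (by positivity)
  refine (sq_integral_mul_le (Lp.memLp p) h1).trans ?_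
  rw [← norm_sq_eq_integral, mul_pow, Real.sq_sqrt]
  · gcongr
  · exact mul_nonneg zero_le_two (integral_nonneg fun _ => sq_nonneg _)

/-- The function `sin (√κ t) / √κ` as an element of `L²(0, x)`. -/
def solutionLp (x κ : ℝ) : Lp ℝ 2 (volume.restrict (Ioc 0 x)) :=
  (memLp_of_continuous (by fun_prop : Continuous fun t => sinKernel κ t) 0 x).toLp _

lemma coeFn_solutionLp (x κ : ℝ) :
    solutionLp x κ =ᵐ[volume.restrict (Ioc 0 x)] fun t => sinKernel κ t :=
  MemLp.coeFn_toLp _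

lemma inner_solutionLp (x κ : ℝ) (p : Lp ℝ 2 (volume.restrict (Ioc 0 x))) :
    inner ℝ (solutionLp x κ) p = ∫ s in Ioc 0 x, p s * sinKernel κ s := by
  conv_lhs => rw [← Lp.toLp_coeFn p (Lp.memLp p), solutionLp, inner_toLp]
  simp_rw [mul_comm]

/-- The finite-rank operator with the kernel built from the partial sum of `H`. -/
def partialOp (β : ℝ) (μ a : ℕ → ℝ) (x : ℝ) (N : ℕ) :
    Lp ℝ 2 (volume.restrict (Ioc 0 x)) →L[ℝ] Lp ℝ 2 (volume.restrict (Ioc 0 x)) :=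
  ∑ n ∈ Finset.range N,
    ((1 / a n) • InnerProductSpace.rankOne ℝ (solutionLp x (μ n)) (solutionLp x (μ n))
      - (1 / freeNorming β n) • InnerProductSpace.rankOne ℝ
        (solutionLp x (freeEigenvalue β n)) (solutionLp x (freeEigenvalue β n)))

lemma diffKernel_termH (β : ℝ) (μ a : ℕ → ℝ) (n : ℕ) (t s : ℝ) :
    diffKernel (termH β μ a n) t s = 1 / a n * (sinKernel (μ n) s * sinKernel (μ n) t)
      - 1 / freeNorming β n *
        (sinKernel (freeEigenvalue β n) s * sinKernel (freeEigenvalue β n) t) := by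
  rw [← half_cosKernel_sub, ← half_cosKernel_sub, diffKernel, termH, termH]
  ring

lemma partialH_succ (β : ℝ) (μ a : ℕ → ℝ) (N : ℕ) (t : ℝ) :
    partialH β μ a (N + 1) t = partialH β μ a N t + termH β μ a N t := by
  rw [partialH_eq_sum, Finset.sum_range_succ, ← partialH_eq_sum]

lemma continuous_diffKernel {h : ℝ → ℝ} (hh : Continuous h) (t : ℝ) :
    Continuous (diffKernel h t) := by
  unfold diffKernel
  fun_prop

/-- By the product formula, each term of `partialH` contributes a difference of two rank-one
kernels. -/
lemma partialOp_apply_ae (β : ℝ) (μ a : ℕ → ℝ) (x : ℝ) (N : ℕ)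
    (p : Lp ℝ 2 (volume.restrict (Ioc 0 x))) :
    partialOp β μ a x N p =ᵐ[volume.restrict (Ioc 0 x)]
      fun t => ∫ s in Ioc 0 x, p s * diffKernel (partialH β μ a N) t s := by
  have hint : ∀ g : ℝ → ℝ, Continuous g →
      Integrable (fun s => p s * g s) (volume.restrict (Ioc 0 x)) := fun g hg =>
    integrable_mul_of_memLp (Lp.memLp p) (memLp_of_continuous hg _ _)
  induction N with
  | zero =>
    have h0 : ∀ t s, diffKernel (partialH β μ a 0) t s = 0 := fun t s => by
      simp [diffKernel, partialH]
    simp only [partialOp, Finset.range_zero, Finset.sum_empty, h0, mul_zero, integral_zero,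
      _root_.zero_apply]
    exact Lp.coeFn_zero _ _ _
  | succ N ih =>
    set u := solutionLp x (μ N)
    set v := solutionLp x (freeEigenvalue β N)
    have hsucc : partialOp β μ a x (N + 1) p = partialOp β μ a x N p
        + ((1 / a N * inner ℝ u p) • u - (1 / freeNorming β N * inner ℝ v p) • v) := by
      simp only [partialOp, Finset.sum_range_succ, _root_.add_apply,
        _root_.sub_apply, _root_.smul_apply,
        InnerProductSpace.rankOne_apply, smul_smul, u, v]
    rw [hsucc]
    filter_upwards [ih, coeFn_solutionLp x (μ N), coeFn_solutionLp x (freeEigenvalue β N),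
      Lp.coeFn_add (partialOp β μ a x N p)
        ((1 / a N * inner ℝ u p) • u - (1 / freeNorming β N * inner ℝ v p) • v),
      Lp.coeFn_sub ((1 / a N * inner ℝ u p) • u) ((1 / freeNorming β N * inner ℝ v p) • v),
      Lp.coeFn_smul (1 / a N * inner ℝ u p) u,
      Lp.coeFn_smul (1 / freeNorming β N * inner ℝ v p) v] with t h1 h2 h3 h4 h5 h6 h7
    rw [h4, Pi.add_apply, h5, Pi.sub_apply, h6, h7, Pi.smul_apply, Pi.smul_apply, h1, h2, h3]
    have e : ∀ s, p s * diffKernel (partialH β μ a (N + 1)) t s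
        = p s * diffKernel (partialH β μ a N) t s
        + (1 / a N * sinKernel (μ N) t * (p s * sinKernel (μ N) s)
        - 1 / freeNorming β N * sinKernel (freeEigenvalue β N) t
          * (p s * sinKernel (freeEigenvalue β N) s)) := fun s => by
      have e1 : diffKernel (partialH β μ a (N + 1)) t s
          = diffKernel (partialH β μ a N) t s + diffKernel (termH β μ a N) t s := by
        simp only [diffKernel, partialH_succ]
        ring
      rw [e1, diffKernel_termH]
      ring
    simp_rw [e]
    have hi1 := (hint (fun s => sinKernel (μ N) s) (by fun_prop)).const_mul
      (1 / a N * sinKernel (μ N) t)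
    have hi2 := (hint (fun s => sinKernel (freeEigenvalue β N) s) (by fun_prop)).const_mul
      (1 / freeNorming β N * sinKernel (freeEigenvalue β N) t)
    have hi0 : Integrable (fun s => p s * diffKernel (partialH β μ a N) t s)
        (volume.restrict (Ioc 0 x)) :=
      hint _ (continuous_diffKernel (continuous_partialH β μ a N) t)
    have hi12 : Integrable (fun s => 1 / a N * sinKernel (μ N) t * (p s * sinKernel (μ N) s)
        - 1 / freeNorming β N * sinKernel (freeEigenvalue β N) t
          * (p s * sinKernel (freeEigenvalue β N) s)) (volume.restrict (Ioc 0 x)) := hi1.sub hi2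
    rw [integral_add hi0 hi12, integral_sub hi1 hi2, integral_const_mul, integral_const_mul,
      ← inner_solutionLp, ← inner_solutionLp]
    simp only [smul_eq_mul, u, v]
    ring

/-! ### Compactness and convergence in operator norm -/

lemma isCompactOperator_rankOne {E : Type*} [NormedAddCommGroup E] [InnerProductSpace ℝ E]
    (u v : E) : IsCompactOperator (InnerProductSpace.rankOne ℝ u v : E →L[ℝ] E) := by
  rw [InnerProductSpace.rankOne_def']
  exact (isCompactOperator_of_locallyCompactSpace_rng
    (ContinuousLinearMap.toSpanSingleton ℝ u)).comp_clm (innerSL ℝ v)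

lemma isCompactOperator_partialOp (β : ℝ) (μ a : ℕ → ℝ) (x : ℝ) (N : ℕ) :
    IsCompactOperator (partialOp β μ a x N) := by
  induction N with
  | zero =>
    simp only [partialOp, Finset.range_zero, Finset.sum_empty]
    exact isCompactOperator_zero
  | succ N ih =>
    rw [partialOp, Finset.sum_range_succ]
    exact ih.add (((isCompactOperator_rankOne _ _).smul _).sub
      ((isCompactOperator_rankOne _ _).smul _))

/-- Cauchy–Schwarz in `s` bounds the image uniformly in `t`; passing from the uniform bound to the
`L²(0, x)` norm costs `√x`. -/
lemma norm_partialOp_sub_le (β : ℝ) (μ a : ℕ → ℝ) {x : ℝ} (hx0 : 0 ≤ x) (hx : x ≤ Real.pi)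
    (M N : ℕ) : ‖partialOp β μ a x M - partialOp β μ a x N‖ ≤ Real.sqrt x * Real.sqrt
      (2 * ∫ s in Ioc 0 (2 * Real.pi), (partialH β μ a M s - partialH β μ a N s) ^ 2) := by
  refine ContinuousLinearMap.opNorm_le_bound _ (by positivity) fun p => ?_
  set D := Real.sqrt (2 * ∫ s in Ioc 0 (2 * Real.pi),
    (partialH β μ a M s - partialH β μ a N s) ^ 2) with hD
  have hbd : ∀ᵐ t ∂(volume.restrict (Ioc 0 x)),
      ‖(partialOp β μ a x M p - partialOp β μ a x N p) t‖ ≤ ‖p‖ * D := by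
    filter_upwards [partialOp_apply_ae β μ a x M p, partialOp_apply_ae β μ a x N p,
      Lp.coeFn_sub (partialOp β μ a x M p) (partialOp β μ a x N p),
      ae_restrict_mem measurableSet_Ioc] with t h1 h2 h3 ht
    have hint : ∀ K, Integrable (fun s => p s * diffKernel (partialH β μ a K) t s)
        (volume.restrict (Ioc 0 x)) := fun K => integrable_mul_of_memLp (Lp.memLp p)
      (memLp_of_continuous (continuous_diffKernel (continuous_partialH β μ a K) t) _ _)
    rw [h3, Pi.sub_apply, h1, h2, ← integral_sub (hint M) (hint N), Real.norm_eq_abs]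
    have e : ∀ s, p s * diffKernel (partialH β μ a M) t s - p s * diffKernel (partialH β μ a N) t s
        = p s * diffKernel (fun y => partialH β μ a M y - partialH β μ a N y) t s := fun s => by
      simp only [diffKernel]
      ring
    simp_rw [e]
    exact abs_integral_mul_diffKernel_le hx (Ioc_subset_Icc_self ht)
      (memLp_of_continuous (by fun_prop) _ _) p
  have h := Lp.norm_le_of_ae_bound (by positivity) hbd
  rw [_root_.sub_apply]
  refine h.trans (le_of_eq ?_)
  have hm : (measureUnivNNReal (volume.restrict (Ioc 0 x)) : ℝ) = x := by
    rw [measureUnivNNReal, ENNReal.coe_toNNReal_eq_toReal]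
    simp [hx0]
  rw [hm, Real.sqrt_eq_rpow]
  norm_num
  ring

lemma IsPerturbation.tendsto_integral_sq {β : ℝ} (hβ : β ∈ Ioo 0 Real.pi) {μ a σ ε : ℕ → ℝ}
    (h : IsPerturbation β μ a σ ε) :
    Tendsto (fun N => ∫ t in Ioc 0 (2 * Real.pi), (partialH β μ a N t - H β μ a t) ^ 2)
      atTop (𝓝 0) := by
  have hm : ∀ N, MemLp (fun t => partialH β μ a N t - H β μ a t) 2
      (volume.restrict (Ioc 0 (2 * Real.pi))) := fun N =>
    (memLp_of_continuous (continuous_partialH β μ a N) _ _).sub (h.memLp_H hβ)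
  have h1 := (ENNReal.tendsto_toReal ENNReal.zero_ne_top).comp (h.tendsto_eLpNorm_partialH_sub hβ)
  have h2 := h1.pow 2
  simp only [ENNReal.toReal_zero, ne_eq, OfNat.ofNat_ne_zero, not_false_eq_true, zero_pow] at h2
  refine h2.congr fun N => ?_
  rw [Function.comp_apply, eLpNorm_two_eq (hm N), ENNReal.toReal_ofReal (Real.sqrt_nonneg _),
    Real.sq_sqrt (integral_nonneg fun _ => sq_nonneg _)]

lemma IsPerturbation.cauchySeq_partialOp {β : ℝ} (hβ : β ∈ Ioo 0 Real.pi) {μ a σ ε : ℕ → ℝ}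
    (h : IsPerturbation β μ a σ ε) {x : ℝ} (hx0 : 0 ≤ x) (hx : x ≤ Real.pi) :
    CauchySeq (partialOp β μ a x) := by
  obtain ⟨δ, hδ, hδb⟩ := h.integral_sq_partialH_sub_le hβ
  have hlim : Tendsto (fun M => Real.sqrt x * Real.sqrt (2 * δ M)) atTop (𝓝 0) := by
    have := ((Real.continuous_sqrt.tendsto _).comp (hδ.const_mul 2)).const_mul (Real.sqrt x)
    simpa using this
  rw [Metric.cauchySeq_iff']
  intro r hr
  obtain ⟨M, hM1, hM2⟩ := (hδb.and ((tendsto_order.1 hlim).2 r hr)).exists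
  refine ⟨M, fun N hN => lt_of_le_of_lt ?_ hM2⟩
  rw [dist_comm, dist_eq_norm]
  refine (norm_partialOp_sub_le β μ a hx0 hx M N).trans ?_
  rw [← intervalIntegral.integral_of_le (by have := Real.pi_pos; positivity)]
  gcongr
  exact hM1 N hN

/-- The limit operator is the integral operator with kernel `F`. -/
lemma IsPerturbation.limit_apply_ae {β : ℝ} (hβ : β ∈ Ioo 0 Real.pi) {μ a σ ε : ℕ → ℝ}
    (h : IsPerturbation β μ a σ ε) {x : ℝ} (hx : x ≤ Real.pi)
    {K : Lp ℝ 2 (volume.restrict (Ioc 0 x)) →L[ℝ] Lp ℝ 2 (volume.restrict (Ioc 0 x))}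
    (hK : Tendsto (partialOp β μ a x) atTop (𝓝 K)) (p : Lp ℝ 2 (volume.restrict (Ioc 0 x))) :
    K p =ᵐ[volume.restrict (Ioc 0 x)] fun t => ∫ s in Ioc 0 x, p s * F β μ a s t := by
  have hKp : Tendsto (fun N => partialOp β μ a x N p) atTop (𝓝 (K p)) :=
    ((ContinuousLinearMap.apply ℝ _ p).continuous.tendsto K).comp hK
  -- Norm convergence gives almost everywhere convergence along a subsequence, while the integrals
  -- against the partial kernels converge for each `t ∈ (0, x]`. The two limits must agree.
  obtain ⟨ns, hns, hae⟩ := (tendstoInMeasure_of_tendsto_Lp hKp).exists_seq_tendsto_ae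
  filter_upwards [hae, ae_all_iff.2 fun N => partialOp_apply_ae β μ a x N p,
    ae_restrict_mem measurableSet_Ioc] with t h1 h2 ht
  have ht' := Ioc_subset_Icc_self ht
  have hpt : Tendsto (fun N => ∫ s in Ioc 0 x, p s * diffKernel (partialH β μ a N) t s) atTop
      (𝓝 (∫ s in Ioc 0 x, p s * F β μ a s t)) := by
    have hlim : Tendsto (fun N => ‖p‖ * Real.sqrt (2 * ∫ t in Ioc 0 (2 * Real.pi),
        (partialH β μ a N t - H β μ a t) ^ 2)) atTop (𝓝 0) := by
      have := ((Real.continuous_sqrt.tendsto _).comp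
        ((h.tendsto_integral_sq hβ).const_mul 2)).const_mul ‖p‖
      simpa using this
    refine tendsto_iff_norm_sub_tendsto_zero.2
      (squeeze_zero (fun _ => norm_nonneg _) (fun N => ?_) hlim)
    have hm : MemLp (fun t => partialH β μ a N t) 2 (volume.restrict (Ioc 0 (2 * Real.pi))) :=
      memLp_of_continuous (by fun_prop) _ _
    have hH := h.memLp_H hβ
    have hF : Integrable (fun s => p s * F β μ a s t) (volume.restrict (Ioc 0 x)) :=
      integrable_mul_of_memLp (Lp.memLp p) (memLp_diffKernel hx ht' hH).1
    rw [← integral_sub (integrable_mul_of_memLp (Lp.memLp p) (memLp_diffKernel hx ht' hm).1) hF,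
      Real.norm_eq_abs]
    have e : ∀ s, p s * diffKernel (partialH β μ a N) t s - p s * F β μ a s t
        = p s * diffKernel (fun y => partialH β μ a N y - H β μ a y) t s := fun s => by
      simp only [diffKernel, F]
      ring
    simp_rw [e]
    exact abs_integral_mul_diffKernel_le hx ht' (hm.sub hH) p
  refine tendsto_nhds_unique h1 ((hpt.comp hns.tendsto_atTop).congr fun k => ?_)
  exact (h2 (ns k)).symm

/-- Bessel's inequality for an orthogonal family that need not be normalised. -/
lemma sum_inner_sq_div_le {E : Type*} [NormedAddCommGroup E] [InnerProductSpace ℝ E] {v : ℕ → E}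
    (hv : ∀ m n, m ≠ n → inner ℝ (v m) (v n) = 0) (q : E) (s : Finset ℕ) :
    ∑ n ∈ s, 1 / ‖v n‖ ^ 2 * inner ℝ (v n) q ^ 2 ≤ ‖q‖ ^ 2 := by
  set c : ℕ → ℝ := fun n => 1 / ‖v n‖ ^ 2 * inner ℝ (v n) q with hc
  set w := ∑ n ∈ s, c n • v n with hw
  have h1 : inner ℝ w q = ∑ n ∈ s, 1 / ‖v n‖ ^ 2 * inner ℝ (v n) q ^ 2 := by
    rw [hw, sum_inner]
    refine Finset.sum_congr rfl fun n _ => ?_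
    rw [real_inner_smul_left, hc]
    ring
  have h2 : inner ℝ w w = ∑ n ∈ s, 1 / ‖v n‖ ^ 2 * inner ℝ (v n) q ^ 2 := by
    conv_lhs => rw [hw]
    rw [sum_inner]
    refine Finset.sum_congr rfl fun n hn => ?_
    rw [inner_sum, Finset.sum_eq_single n]
    · rw [real_inner_smul_left, real_inner_smul_right, real_inner_self_eq_norm_sq, hc]
      -- For a zero vector both sides vanish, as `1 / 0 = 0`.
      by_cases h0 : ‖v n‖ = 0
      · simp [h0]
      · field_simp
    · intro m _ hmn
      rw [real_inner_smul_left, real_inner_smul_right, hv n m hmn.symm]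
      simp
    · exact fun h => absurd hn h
  have h3 := norm_sub_sq_real q w
  rw [real_inner_comm, h1, ← real_inner_self_eq_norm_sq w, h2] at h3
  nlinarith [sq_nonneg ‖q - w‖]

lemma norm_solutionLp_sq (x κ : ℝ) :
    ‖solutionLp x κ‖ ^ 2 = ∫ t in Ioc 0 x, sinKernel κ t ^ 2 := by
  rw [norm_sq_eq_integral]
  refine integral_congr_ae ?_
  filter_upwards [coeFn_solutionLp x κ] with t ht
  rw [ht]

lemma memLp_indicator {x : ℝ} (hx : x ≤ Real.pi) {p : ℝ → ℝ}
    (hp : MemLp p 2 (volume.restrict (Ioc 0 x))) :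
    MemLp ((Ioc 0 x).indicator p) 2 (volume.restrict (Ioc 0 Real.pi)) := by
  rw [memLp_indicator_iff_restrict measurableSet_Ioc,
    Measure.restrict_restrict_of_subset (Ioc_subset_Ioc_right hx)]
  exact hp

lemma integral_indicator_mul {x : ℝ} (hx : x ≤ Real.pi) (p g : ℝ → ℝ) :
    ∫ t in Ioc 0 Real.pi, (Ioc 0 x).indicator p t * g t = ∫ t in Ioc 0 x, p t * g t := by
  have e : ∀ t, (Ioc 0 x).indicator p t * g t = (Ioc 0 x).indicator (fun t => p t * g t) t :=
    fun t => by rw [indicator_mul_left]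
  simp_rw [e]
  rw [setIntegral_indicator measurableSet_Ioc,
    inter_eq_self_of_subset_right (Ioc_subset_Ioc_right hx)]

/-- The free eigenfunctions are orthogonal on the whole of `(0, π)`, so `p` is extended by zero
before Bessel's inequality is applied. -/
lemma sum_inner_freeEigenvalue_le {β : ℝ} (hβ : β ∈ Ioo 0 Real.pi) {x : ℝ} (hx : x ≤ Real.pi)
    (p : Lp ℝ 2 (volume.restrict (Ioc 0 x))) (N : ℕ) :
    ∑ n ∈ Finset.range N, 1 / freeNorming β n *
      inner ℝ (solutionLp x (freeEigenvalue β n)) p ^ 2 ≤ ‖p‖ ^ 2 := by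
  have hpi := Real.pi_pos.le
  have hq := memLp_indicator hx (Lp.memLp p)
  have horth : ∀ m n, m ≠ n → inner ℝ (solutionLp Real.pi (freeEigenvalue β m))
      (solutionLp Real.pi (freeEigenvalue β n)) = 0 := by
    intro m n hmn
    rw [solutionLp, solutionLp, inner_toLp, ← intervalIntegral.integral_of_le hpi]
    exact integral_sinKernel_mul_eq_zero (freeEigenvalue_mem hβ m).1 (freeEigenvalue_mem hβ n).1
      fun h => hmn (freeEigenvalue_injective hβ h)
  have h := sum_inner_sq_div_le horth (hq.toLp _) (Finset.range N)
  have h1 : ∀ n, ‖solutionLp Real.pi (freeEigenvalue β n)‖ ^ 2 = freeNorming β n := fun n => by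
    rw [norm_solutionLp_sq, freeNorming, intervalIntegral.integral_of_le hpi]
  have h2 : ∀ n, inner ℝ (solutionLp Real.pi (freeEigenvalue β n)) (hq.toLp _)
      = inner ℝ (solutionLp x (freeEigenvalue β n)) p := fun n => by
    rw [solutionLp, inner_toLp, inner_solutionLp, ← integral_indicator_mul hx]
    simp_rw [mul_comm]
  have h3 : ‖hq.toLp _‖ ^ 2 = ‖p‖ ^ 2 := by
    rw [← real_inner_self_eq_norm_sq, inner_toLp, integral_indicator_mul hx,
      norm_sq_eq_integral]
    refine setIntegral_congr_fun measurableSet_Ioc fun t ht => ?_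
    rw [indicator_of_mem ht, sq]
  simpa only [h1, h2, h3] using h

lemma inner_partialOp (β : ℝ) (μ a : ℕ → ℝ) (x : ℝ) (N : ℕ)
    (p : Lp ℝ 2 (volume.restrict (Ioc 0 x))) :
    inner ℝ p (partialOp β μ a x N p)
      = (∑ n ∈ Finset.range N, 1 / a n * inner ℝ (solutionLp x (μ n)) p ^ 2)
      - ∑ n ∈ Finset.range N, 1 / freeNorming β n *
        inner ℝ (solutionLp x (freeEigenvalue β n)) p ^ 2 := by
  rw [partialOp, ← Finset.sum_sub_distrib, _root_.sum_apply, inner_sum]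
  refine Finset.sum_congr rfl fun n _ => ?_
  rw [_root_.sub_apply, _root_.smul_apply, _root_.smul_apply, InnerProductSpace.rankOne_apply,
    InnerProductSpace.rankOne_apply, inner_sub_right, real_inner_smul_right, real_inner_smul_right,
    real_inner_smul_right, real_inner_smul_right, real_inner_comm p (solutionLp x (μ n)),
    real_inner_comm p (solutionLp x (freeEigenvalue β n))]
  ring

/-- The homogeneous Gelfand–Levitan equation has only the trivial solution. -/
lemma eq_zero_of_limit_eq_neg {β : ℝ} (hβ : β ∈ Ioo 0 Real.pi) {μ a : ℕ → ℝ} (ha : ∀ n, 0 < a n)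
    (hcompl : IsCompleteSystem (range μ)) {x : ℝ} (hx : x ≤ Real.pi)
    {K : Lp ℝ 2 (volume.restrict (Ioc 0 x)) →L[ℝ] Lp ℝ 2 (volume.restrict (Ioc 0 x))}
    (hK : Tendsto (partialOp β μ a x) atTop (𝓝 K)) {p : Lp ℝ 2 (volume.restrict (Ioc 0 x))}
    (hp : K p = -p) : p = 0 := by
  have hKp : Tendsto (fun N => inner ℝ p (partialOp β μ a x N p) + ‖p‖ ^ 2) atTop (𝓝 0) := by
    have h1 : Tendsto (fun N => partialOp β μ a x N p) atTop (𝓝 (K p)) :=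
      ((ContinuousLinearMap.apply ℝ _ p).continuous.tendsto K).comp hK
    have h2 := ((tendsto_const_nhds (x := p)).inner (𝕜 := ℝ) h1).add_const (‖p‖ ^ 2)
    rwa [hp, inner_neg_right, real_inner_self_eq_norm_sq, neg_add_cancel] at h2
  have hzero : ∀ m, inner ℝ (solutionLp x (μ m)) p = 0 := by
    intro m
    -- For `N > m` the quadratic form plus `‖p‖²` is at least this single term: the other perturbed
    -- terms are nonnegative, and Bessel's inequality absorbs the free sum.
    have hle : 1 / a m * inner ℝ (solutionLp x (μ m)) p ^ 2 ≤ 0 := by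
      refine ge_of_tendsto hKp ?_
      filter_upwards [eventually_gt_atTop m] with N hN
      have h1 := Finset.single_le_sum (f := fun n => 1 / a n * inner ℝ (solutionLp x (μ n)) p ^ 2)
        (fun n _ => by have := ha n; positivity) (Finset.mem_range.2 hN)
      have h2 := sum_inner_freeEigenvalue_le hβ hx p N
      rw [inner_partialOp]
      linarith
    have h3 : inner ℝ (solutionLp x (μ m)) p ^ 2 ≤ 0 := by
      have := one_div_pos.2 (ha m)
      nlinarith [sq_nonneg (inner ℝ (solutionLp x (μ m)) p)]
    exact pow_eq_zero_iff two_ne_zero |>.1 (le_antisymm h3 (sq_nonneg _))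
  have h0 := hcompl _ (memLp_indicator hx (Lp.memLp p)) (by
    rintro _ ⟨n, rfl⟩
    rw [intervalIntegral.integral_of_le Real.pi_pos.le, integral_indicator_mul hx,
      ← inner_solutionLp, hzero])
  refine Lp.eq_zero_iff_ae_eq_zero.2 ?_
  filter_upwards [ae_restrict_of_ae_restrict_of_subset (Ioc_subset_Ioc_right hx) h0,
    ae_restrict_mem measurableSet_Ioc] with t h1 ht
  rwa [indicator_of_mem ht] at h1

end SturmLiouville

end

/-! ### The Fredholm alternative and the conclusion -/

open SturmLiouville in
/-- For admissible data, the series defining `H` converges on `(0, 2π)`, and for each `x ∈ (0, π]`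
the Gelfand–Levitan equation has a unique solution in `L²[0, x)`. -/
theorem lemma5p1 (β : ℝ) (hβ : β ∈ Set.Ioo 0 Real.pi) (μ a : ℕ → ℝ)
    (hdata : SturmLiouville.SpectralData β μ a) :
    (∀ t ∈ Set.Ioo 0 (2 * Real.pi),
      Tendsto (fun N => SturmLiouville.partialH β μ a N t) atTop
        (𝓝 (SturmLiouville.H β μ a t))) ∧
    ∀ x ∈ Set.Ioc 0 Real.pi,
      ∃ p : ℝ → ℝ, MemLp p 2 (volume.restrict (Set.Ico 0 x)) ∧
        (∀ t ∈ Set.Ico 0 x,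
          IntervalIntegrable (fun s => p s * SturmLiouville.F β μ a s t) volume 0 x ∧
          SturmLiouville.GelfandLevitanAt β μ a x p t) ∧
        ∀ r : ℝ → ℝ, MemLp r 2 (volume.restrict (Set.Ico 0 x)) →
          (∀ᵐ t ∂(volume.restrict (Set.Ico 0 x)),
            SturmLiouville.GelfandLevitanAt β μ a x r t) →
          r =ᵐ[volume.restrict (Set.Ico 0 x)] p := by
  obtain ⟨σ, ε, h⟩ := hdata.exists_isPerturbation hβ
  refine ⟨fun t ht => h.tendsto_partialH hβ ht, fun x hx => ?_⟩
  rw [restrict_Ico_eq_restrict_Ioc]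
  have hcompl : IsCompleteSystem (range μ) := h.isCompleteSystem hβ hdata.1
  obtain ⟨K, hK⟩ := cauchySeq_tendsto_of_complete (h.cauchySeq_partialOp hβ hx.1.le hx.2)
  have hcomp : IsCompactOperator K :=
    isCompactOperator_of_tendsto hK (Eventually.of_forall (isCompactOperator_partialOp β μ a x))
  have hinj : ∀ p, K p = -p → p = 0 := fun p hp =>
    eq_zero_of_limit_eq_neg hβ hdata.2.1 hcompl hx.2 hK hp
  have hFm : ∀ t ∈ Icc 0 x, MemLp (fun s => F β μ a s t) 2 (volume.restrict (Ioc 0 x)) :=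
    fun t ht => (memLp_diffKernel hx.2 ht (h.memLp_H hβ)).1
  have hsymm : ∀ s t, F β μ a s t = F β μ a t s := fun s t => by
    rw [F, F, abs_sub_comm, add_comm]
  have hgm : MemLp (fun t => F β μ a x t) 2 (volume.restrict (Ioc 0 x)) := by
    simp_rw [hsymm x]
    exact hFm x ⟨hx.1.le, le_rfl⟩
  set g := hgm.toLp _ with hg
  have hGL : ∀ p : Lp ℝ 2 (volume.restrict (Ioc 0 x)), (p + g + K p = 0 ↔
      ∀ᵐ t ∂(volume.restrict (Ioc 0 x)), GelfandLevitanAt β μ a x p t) := by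
    intro p
    rw [Lp.eq_zero_iff_ae_eq_zero]
    refine eventually_congr ?_
    filter_upwards [Lp.coeFn_add (p + g) (K p), Lp.coeFn_add p g, hgm.coeFn_toLp,
      h.limit_apply_ae hβ hx.2 hK p] with t h1 h2 h3 h4
    rw [h1, Pi.add_apply, h2, Pi.add_apply, h3, h4, GelfandLevitanAt,
      intervalIntegral.integral_of_le hx.1.le, Pi.zero_apply]
  obtain ⟨q, hq⟩ : ∃ q, q + g + K q = 0 := by
    -- For the compact `K`, the number `-1` is either an eigenvalue, which injectivity of `1 + K`
    -- excludes, or a point of the resolvent set.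
    have hres := (hcomp.hasEigenvalue_or_mem_resolventSet (μ := (-1 : ℝ)) (by norm_num)).resolve_left
      (fun hev => by
        obtain ⟨p, hp⟩ := hev.exists_hasEigenvector
        exact hp.2 (hinj p (by simpa using hp.apply_eq_smul)))
    obtain ⟨u, hu⟩ := spectrum.mem_resolventSet_iff.1 hres
    refine ⟨(↑u⁻¹ : Lp ℝ 2 (volume.restrict (Ioc 0 x)) →L[ℝ] _) g, ?_⟩
    set q := (↑u⁻¹ : Lp ℝ 2 (volume.restrict (Ioc 0 x)) →L[ℝ]
      Lp ℝ 2 (volume.restrict (Ioc 0 x))) g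
    have h1 : (u : Lp ℝ 2 (volume.restrict (Ioc 0 x)) →L[ℝ] _) q = g := by
      have := congrArg (fun T : Lp ℝ 2 (volume.restrict (Ioc 0 x)) →L[ℝ] _ => T g) u.mul_inv
      exact this
    -- The unit `u` is `-1 - K`, so `u q = g` is the equation `q + g + K q = 0`.
    rw [hu, _root_.sub_apply] at h1
    have h2 : (algebraMap ℝ (Lp ℝ 2 (volume.restrict (Ioc 0 x)) →L[ℝ]
        Lp ℝ 2 (volume.restrict (Ioc 0 x))) (-1)) q = -q := by
      simp [Algebra.algebraMap_eq_smul_one]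
    rw [h2] at h1
    rw [← h1]
    abel
  -- The class `q` satisfies the equation only almost everywhere. Reading the equation as the
  -- definition of `p` selects a representative that satisfies it at every `t`, since the integral
  -- depends only on the class.
  set p : ℝ → ℝ := fun t => -F β μ a x t - ∫ s in (0 : ℝ)..x, q s * F β μ a s t with hp
  have hpq : p =ᵐ[volume.restrict (Ioc 0 x)] q := by
    filter_upwards [(hGL q).1 hq] with t ht
    rw [GelfandLevitanAt] at ht
    rw [hp]
    linarith
  have hpm : MemLp p 2 (volume.restrict (Ioc 0 x)) := (Lp.memLp q).ae_eq hpq.symm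
  refine ⟨p, hpm, fun t ht => ⟨?_, ?_⟩, fun r hr hrGL => ?_⟩
  · rw [intervalIntegrable_iff_integrableOn_Ioc_of_le hx.1.le]
    exact integrable_mul_of_memLp hpm (hFm t (Ico_subset_Icc_self ht))
  · have h1 : ∫ s in (0 : ℝ)..x, p s * F β μ a s t = ∫ s in (0 : ℝ)..x, q s * F β μ a s t := by
      rw [intervalIntegral.integral_of_le hx.1.le, intervalIntegral.integral_of_le hx.1.le]
      refine integral_congr_ae ?_
      filter_upwards [hpq] with s hs
      rw [hs]
    rw [GelfandLevitanAt, h1, hp]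
    ring
  · have hr1 := hr.coeFn_toLp
    have h1 : hr.toLp r + g + K (hr.toLp r) = 0 := by
      refine (hGL _).2 ?_
      filter_upwards [hrGL, hr1] with t ht h2
      rw [GelfandLevitanAt] at ht ⊢
      rw [h2]
      refine Eq.trans ?_ ht
      congr 1
      rw [intervalIntegral.integral_of_le hx.1.le, intervalIntegral.integral_of_le hx.1.le]
      refine integral_congr_ae ?_
      filter_upwards [hr1] with s hs
      rw [hs]
    have h2 : hr.toLp r = q := by
      refine sub_eq_zero.1 (hinj _ ?_)
      rw [map_sub]
      have h3 := h1.trans hq.symm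
      have h4 : K (hr.toLp r) - K q - -(hr.toLp r - q)
          = (hr.toLp r + g + K (hr.toLp r)) - (q + g + K q) := by abel
      rw [← sub_eq_zero, h4, h3, sub_self]
    filter_upwards [hr1, hpq] with t h3 h4
    rw [← h3, h4, h2]
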